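/- For a sequence $d=(d_1,\dots,d_N)$ of positive integers with sum $m=\sum_i d_i$ put $Q(d)=\frac1m\sum_i d_i(d_i-2)$ and $R(d)=\frac1m\sum_i d_i(d_i-2)^2$. If $d$ is graphical, let $\mathbb G(d)$ be a uniformly random simple graph on $\{1,\dots,N\}$ in which every vertex $i$ has degree $d_i$, and let $L_1(G)$ denote the order of a largest connected component of a graph $G$. **Proposition.** Let $-1<Q<0$ be fixed and put $\varepsilon=-Q$. Let $\Delta=\Delta_n$ be a sequence of non-negative integers with $\Delta=o(\sqrt n)$ and $\log n=o(\Delta)$ as $n\to\infty$. Then there are degree sequences $\widehat d_n$ such that, for all sufficiently large $n$, $\widehat d_n$ is graphical, has maximum degree $\Delta_n$, and consists of $\ell_n=\lfloor(1-\varepsilon)n/\Delta_n^2\rfloor$ vertices of degree $\Delta_n$ and otherwise only of vertices of degree $1$; the total number of vertices is $n$, or $n+1$ if with $n$ vertices the sum of the degrees would be odd. Moreover, as $n\to\infty$, $$Q(\widehat d_n)\sim Q,\qquad R_n:=R(\widehat d_n)\sim(1-\varepsilon)\Delta_n=(1+Q)\Delta_n ,$$ and there is a sequence $\delta_n\to0$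 such that $$\mathbb P\left[L_1(\mathbb G(\widehat d_n))\ \ge\ (1+\delta_n)\,\frac{2R_n}{Q^2}\,\log\left(\frac{n}{R_n^2}\right)\right]\longrightarrow 1 .$$ -/

import Mathlib

open Filter Asymptotics
open scoped Topology

namespace DegreeSequence

variable {V : Type*} [Fintype V]

/-- `m`, the sum of the degrees. -/
def degreeSum (d : V → ℕ) : ℕ := ∑ v, d v

/-- The largest entry of the degree sequence. -/
def maxDegree (d : V → ℕ) : ℕ := Finset.univ.sup d

/-- `Q(d) = (1/m) ∑ d_v (d_v - 2)`. -/
noncomputable def Q (d : V → ℕ) : ℝ :=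
  (1 / (degreeSum d : ℝ)) * ∑ v, (d v : ℝ) * ((d v : ℝ) - 2)

/-- `R(d) = (1/m) ∑ d_v (d_v - 2)²`. -/
noncomputable def R (d : V → ℕ) : ℝ :=
  (1 / (degreeSum d : ℝ)) * ∑ v, (d v : ℝ) * ((d v : ℝ) - 2) ^ 2

open Classical in
/-- The simple graphs on `V` in which every vertex `v` has degree `d v`. -/
def realizations (d : V → ℕ) : Set (SimpleGraph V) :=
  {G | ∀ v, G.degree v = d v}

/-- The sequence is the degree sequence of at least one simple graph. -/
def IsGraphical (d : V → ℕ) : Prop := (realizations d).Nonempty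

/-- The law of the uniform model: the uniform distribution on the simple graphs with degree
sequence `d` (the zero measure if there are none). -/
noncomputable def uniformModel (d : V → ℕ) : MeasureTheory.Measure (SimpleGraph V) :=
  ProbabilityTheory.uniformOn (realizations d)

end DegreeSequence

/-- The order of a largest connected component of a finite graph. -/
noncomputable def largestComponentOrder {V : Type*} [Finite V] (G : SimpleGraph V) : ℕ :=
  ⨆ c : G.ConnectedComponent, c.supp.ncard

/-! Call the vertices of degree `Δ` hubs, the others leaves, and let the hub graph be the set of
edges between hubs. Write `ℓ` for the number of hubs, `lam = 1 + Q`, and `p` for the number of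
leaf–leaf edges when no two hubs are adjacent. Switching `uv, xy` to `ux, vy` (hubs `u`, `v`, leaves
`x`, `y`) shows that the number of realizations with hub graph `E` is proportional to an explicit
weight (`sum_leaf_pairs_eq`, `card_extensions`). An edge between hubs has odds about `Δ² / (2p)`,
which is asymptotically `lam / ℓ`, so the hub graph resembles a subcritical binomial random graph
with mean degree `lam < 1`.

In such a graph the component of a fixed vertex has order at least `k` with probability `exp(-(I +
o(1)) k)`, where `I = lam - 1 - log lam`. Only the lower bound is needed. It comes from counting
forests grown in layers of constant size `b`, which are easier to count than all trees
(`le_card_layered`, `le_largeWeight`). Per layer they give `b^b / b! * (lam * exp(-lam))^b`, whose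
`b`-th root tends to `exp(-I)` as `b` grows (`exists_pow_lt`).

Once the component of one hub is revealed, the rest is a hub graph of the same kind on the remaining
hubs, with `p` slightly larger (`partition_eq_sum_rooted`). Hence many explorations can be run in
succession, and with high probability one finds about `c * log ℓ` hubs, for any `c < 1 / I`
(`smallPartition_le_pow`, `exists_exploration_parameters`). Since `log ℓ = o(Δ)`, no hub spends a
positive fraction of its degree on other hubs (`sum_weight_deg_ge_le`), so this component carries
almost `Δ` leaves per hub (`le_largestComponentOrder`).

Finally `R ~ lam * Δ` and `log (n / R²) ~ log ℓ`, so the target is `(2 * lam / Q²) * Δ * log ℓ` up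
to a factor tending to 1. The strict inequality `I < Q² / (2 * lam)` of `sub_one_sub_log_lt` leaves
room for a suitable `c`, and even `δ = 0` is enough. -/

set_option linter.unusedSectionVars false

/-! ### Edge sets, degrees and weights of hub graphs -/

namespace HubGraph

variable {U : Type*} [DecidableEq U]

/-- The degree of `v` in the graph with edge set `E`. -/
def deg (E : Finset (Sym2 U)) (v : U) : ℕ := (E.filter fun e => v ∈ e).card

/-- All possible edges inside `A`. -/
def pairs (A : Finset U) : Finset (Sym2 U) := A.sym2.filter fun e => ¬ e.IsDiag

lemma mem_pairs {A : Finset U} {e : Sym2 U} :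
    e ∈ pairs A ↔ (∀ a ∈ e, a ∈ A) ∧ ¬ e.IsDiag := by
  simp [pairs, Finset.mem_sym2_iff]

lemma mk_mem_pairs {A : Finset U} {u v : U} :
    s(u, v) ∈ pairs A ↔ (u ∈ A ∧ v ∈ A) ∧ u ≠ v := by
  simp [mem_pairs]

lemma pairs_mono {A B : Finset U} (h : A ⊆ B) : pairs A ⊆ pairs B := fun e he => by
  rw [mem_pairs] at *
  exact ⟨fun a ha => h (he.1 a ha), he.2⟩

lemma disjoint_pairs {A B : Finset U} (h : Disjoint A B) : Disjoint (pairs A) (pairs B) := by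
  rw [Finset.disjoint_left]
  intro e h1 h2
  induction e using Sym2.ind with | _ u v =>
  rw [mk_mem_pairs] at h1 h2
  exact Finset.disjoint_left.1 h h1.1.1 h2.1.1

lemma card_pairs_le (A : Finset U) : (pairs A).card ≤ A.card ^ 2 := by
  have : pairs A ⊆ (A ×ˢ A).image (fun p => s(p.1, p.2)) := by
    intro e he
    induction e using Sym2.ind with | _ u v =>
    rw [mk_mem_pairs] at he
    exact Finset.mem_image.2 ⟨(u, v), by simp [he.1], rfl⟩
  calc _ ≤ _ := Finset.card_le_card this
    _ ≤ _ := Finset.card_image_le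
    _ = _ := by rw [Finset.card_product, sq]

@[simp] lemma deg_empty (v : U) : deg (∅ : Finset (Sym2 U)) v = 0 := by simp [deg]

lemma deg_insert {E : Finset (Sym2 U)} {e : Sym2 U} (he : e ∉ E) (v : U) :
    deg (insert e E) v = deg E v + if v ∈ e then 1 else 0 := by
  unfold deg
  rw [Finset.filter_insert]
  split_ifs with h
  · rw [Finset.card_insert_of_notMem (by simp [he])]
  · rfl

lemma deg_union {E F : Finset (Sym2 U)} (h : Disjoint E F) (v : U) :
    deg (E ∪ F) v = deg E v + deg F v := by
  unfold deg
  rw [Finset.filter_union, Finset.card_union_of_disjoint (Finset.disjoint_filter_filter h)]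

lemma deg_le_card (E : Finset (Sym2 U)) (v : U) : deg E v ≤ E.card :=
  Finset.card_filter_le _ _

lemma deg_eq_zero {E : Finset (Sym2 U)} {A : Finset U} (hE : E ⊆ pairs A) {v : U} (hv : v ∉ A) :
    deg E v = 0 := by
  unfold deg
  rw [Finset.card_eq_zero, Finset.filter_eq_empty_iff]
  intro e he hve
  exact hv ((mem_pairs.1 (hE he)).1 v hve)

lemma deg_eq_card_adj (E : Finset (Sym2 U)) (A : Finset U)
    (v : U) (hE : ∀ u, s(v, u) ∈ E → u ∈ A) :
    deg E v = (A.filter fun u => s(v, u) ∈ E).card := by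
  unfold deg
  symm
  apply Finset.card_bij (fun u _ => s(v, u))
  · intro u hu
    simp only [Finset.mem_filter] at hu ⊢
    exact ⟨hu.2, by simp⟩
  · intro a _ b _ hab
    have : a = b ∨ v = b ∧ a = v := by simpa using hab
    grind
  · intro e he
    rw [Finset.mem_filter] at he
    obtain ⟨u, rfl⟩ := he.2
    exact ⟨u, by simp [he.1, hE u he.1], rfl⟩

variable [Fintype U]

lemma sum_deg {E : Finset (Sym2 U)} {A : Finset U} (hE : E ⊆ pairs A) :
    ∑ v, deg E v = 2 * E.card := by
  unfold deg
  simp_rw [Finset.card_filter]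
  rw [Finset.sum_comm, Finset.sum_const_nat (m := 2)]
  · ring
  · intro e he
    rw [← Finset.card_filter]
    have hd := (mem_pairs.1 (hE he)).2
    induction e using Sym2.ind with | _ u v =>
    have : (Finset.univ.filter fun a => a ∈ s(u, v)) = {u, v} := by ext; simp
    rw [this, Finset.card_pair (by simpa using hd)]

/-- The number of ways to complete the hub graph `E` to a realization is proportional to this
weight, if without edges between hubs there are `p` edges joining two leaves. -/
noncomputable def weight (Δ p : ℕ) (E : Finset (Sym2 U)) : ℝ :=
  (∏ v, (Δ.descFactorial (deg E v) : ℝ)) / (2 ^ E.card * ((p + 1).ascFactorial E.card : ℝ))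

lemma weight_nonneg (Δ p : ℕ) (E : Finset (Sym2 U)) : 0 ≤ weight Δ p E := by
  unfold weight; positivity

@[simp] lemma weight_empty (Δ p : ℕ) : weight Δ p (∅ : Finset (Sym2 U)) = 1 := by simp [weight]

/-- A new edge adds one factor to the falling factorials at its two ends and one to the rising
factorial. The form without division mirrors the double count in `sum_leaf_pairs_eq`. -/
lemma weight_insert (Δ p : ℕ) {E : Finset (Sym2 U)} {u v : U} (huv : u ≠ v) (he : s(u, v) ∉ E) :
    weight Δ p (insert s(u, v) E) * (2 * (p + E.card + 1)) =
      weight Δ p E * (((Δ - deg E u : ℕ) : ℝ) * ((Δ - deg E v : ℕ) : ℝ)) := by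
  have hprod : (∏ w, (Δ.descFactorial (deg (insert s(u, v) E) w) : ℝ)) =
      (∏ w, (Δ.descFactorial (deg E w) : ℝ)) *
        (((Δ - deg E u : ℕ) : ℝ) * ((Δ - deg E v : ℕ) : ℝ)) := by
    have h1 : ∀ w, (Δ.descFactorial (deg (insert s(u, v) E) w) : ℝ) =
        (Δ.descFactorial (deg E w) : ℝ) *
          ((if w = u then ((Δ - deg E u : ℕ) : ℝ) else 1) *
            (if w = v then ((Δ - deg E v : ℕ) : ℝ) else 1)) := by
      intro w
      rw [deg_insert he]
      by_cases h1 : w = u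
      · subst h1
        simp [huv, Nat.descFactorial_succ, mul_comm]
      · by_cases h2 : w = v
        · subst h2
          simp [h1, Nat.descFactorial_succ, mul_comm]
        · simp [h1, h2]
    simp_rw [h1]
    rw [Finset.prod_mul_distrib, Finset.prod_mul_distrib]
    simp
  unfold weight
  rw [hprod, Finset.card_insert_of_notMem he, Nat.ascFactorial_succ]
  have : ((p + 1).ascFactorial E.card : ℝ) ≠ 0 := by
    exact_mod_cast (Nat.ascFactorial_pos p E.card).ne'
  push_cast
  field_simp
  ring

/-- The upper bound for the odds of a single edge between hubs. -/
noncomputable def odds (Δ p : ℕ) : ℝ := (Δ : ℝ) ^ 2 / (2 * (p + 1))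

lemma odds_nonneg (Δ p : ℕ) : 0 ≤ odds Δ p := by unfold odds; positivity

lemma odds_anti (Δ : ℕ) {p q : ℕ} (h : p ≤ q) : odds Δ q ≤ odds Δ p := by
  unfold odds
  have : (p : ℝ) ≤ q := by exact_mod_cast h
  gcongr

lemma weight_insert_le (Δ p : ℕ) {E : Finset (Sym2 U)} {e : Sym2 U} (hd : ¬ e.IsDiag)
    (he : e ∉ E) : weight Δ p (insert e E) ≤ odds Δ p * weight Δ p E := by
  induction e using Sym2.ind with | _ u v =>
  have h := weight_insert Δ p (by simpa using hd) he
  have h2 : (0 : ℝ) < 2 * (p + E.card + 1) := by positivity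
  rw [eq_comm, ← div_eq_iff h2.ne'] at h
  rw [← h]
  have h3 : ((Δ - deg E u : ℕ) : ℝ) ≤ Δ := by exact_mod_cast Nat.sub_le _ _
  have h4 : ((Δ - deg E v : ℕ) : ℝ) ≤ Δ := by exact_mod_cast Nat.sub_le _ _
  have := weight_nonneg Δ p E
  calc _ ≤ weight Δ p E * ((Δ : ℝ) * Δ) / (2 * (p + 1)) := by
        gcongr
        simp
    _ = _ := by unfold odds; ring

lemma weight_union_le (Δ p : ℕ) {E F : Finset (Sym2 U)} (hF : ∀ e ∈ F, ¬ e.IsDiag)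
    (h : Disjoint E F) : weight Δ p (E ∪ F) ≤ odds Δ p ^ F.card * weight Δ p E := by
  induction F using Finset.induction_on with
  | empty => simp
  | insert e F he ih =>
    rw [Finset.disjoint_insert_right] at h
    rw [Finset.union_insert, Finset.card_insert_of_notMem he, pow_succ']
    have h1 := weight_insert_le Δ p (E := E ∪ F) (hF e (by simp)) (by simp [he, h.1])
    have h2 := ih (fun e he => hF e (by simp [he])) h.2
    calc _ ≤ _ := h1
      _ ≤ odds Δ p * _ := mul_le_mul_of_nonneg_left h2 (odds_nonneg _ _)
      _ = _ := by ring

/-- Weights are multiplicative over vertex-disjoint unions, up to the shift of `p`. -/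
lemma weight_union (Δ p : ℕ) {S T : Finset U} (hST : Disjoint S T) {K E : Finset (Sym2 U)}
    (hK : K ⊆ pairs S) (hE : E ⊆ pairs T) :
    weight Δ p (K ∪ E) = weight Δ p K * weight Δ (p + K.card) E := by
  have hd : Disjoint K E := Finset.disjoint_of_subset_left hK
    (Finset.disjoint_of_subset_right hE (disjoint_pairs hST))
  have hprod : (∏ w, (Δ.descFactorial (deg (K ∪ E) w) : ℝ)) =
      (∏ w, (Δ.descFactorial (deg K w) : ℝ)) * ∏ w, (Δ.descFactorial (deg E w) : ℝ) := by
    rw [← Finset.prod_mul_distrib]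
    refine Finset.prod_congr rfl fun w _ => ?_
    rw [deg_union hd]
    by_cases hw : w ∈ S
    · rw [deg_eq_zero hE (Finset.disjoint_left.1 hST hw)]; simp
    · rw [deg_eq_zero hK hw]; simp
  unfold weight
  rw [hprod, Finset.card_union_of_disjoint hd, ← Nat.ascFactorial_mul_ascFactorial (p + 1)]
  rw [show p + 1 + K.card = p + K.card + 1 by ring]
  push_cast
  rw [pow_add]
  field_simp

/-- The falling factorial vanishes as soon as a degree exceeds `Δ`, so only graphs with degrees at
most `Δ` carry weight. -/
lemma card_mul_two_le_of_weight_ne_zero {Δ p : ℕ} {A : Finset U} {E : Finset (Sym2 U)}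
    (hE : E ⊆ pairs A) (h : weight Δ p E ≠ 0) : 2 * E.card ≤ A.card * Δ := by
  have h1 : ∀ v, deg E v ≤ Δ := by
    intro v
    by_contra hv
    apply h
    unfold weight
    rw [Finset.prod_eq_zero (Finset.mem_univ v), zero_div]
    rw [Nat.descFactorial_of_lt (not_le.1 hv)]
    simp
  rw [← sum_deg hE, ← Finset.sum_subset (Finset.subset_univ A)
    (fun v _ hv => deg_eq_zero hE hv)]
  exact Finset.sum_le_card_nsmul _ _ _ fun v _ => h1 v

/-- The total weight of the hub graphs on `A`. -/
noncomputable def partition (Δ p : ℕ) (A : Finset U) : ℝ :=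
  ∑ E ∈ (pairs A).powerset, weight Δ p E

lemma partition_pos (Δ p : ℕ) (A : Finset U) : 0 < partition Δ p A := by
  unfold partition
  refine Finset.sum_pos' (fun _ _ => weight_nonneg _ _ _) ⟨∅, by simp, by simp⟩

/-- Each further possible edge is either absent or present, and its presence multiplies the weight
by at most `odds Δ p`. -/
lemma sum_weight_union_le (Δ p : ℕ) {F : Finset (Sym2 U)} (G : Finset (Sym2 U))
    (hG : ∀ e ∈ G, ¬ e.IsDiag) :
    ∑ E ∈ (F ∪ G).powerset, weight Δ p E ≤
      (1 + odds Δ p) ^ G.card * ∑ E ∈ F.powerset, weight Δ p E := by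
  induction G using Finset.induction_on with
  | empty => simp
  | insert e G he ih =>
    have ih := ih fun e he => hG e (by simp [he])
    have hnn : 0 ≤ ∑ E ∈ F.powerset, weight Δ p E :=
      Finset.sum_nonneg fun _ _ => weight_nonneg _ _ _
    have ho := odds_nonneg Δ p
    rw [Finset.union_insert, Finset.card_insert_of_notMem he, pow_succ']
    by_cases heF : e ∈ F
    · rw [Finset.insert_eq_of_mem (by simp [heF])]
      refine ih.trans ?_
      gcongr
      nlinarith [pow_nonneg (show 0 ≤ 1 + odds Δ p by positivity) G.card]
    · have heFG : e ∉ F ∪ G := by simp [heF, he]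
      rw [Finset.sum_powerset_insert heFG]
      have h1 : ∑ E ∈ (F ∪ G).powerset, weight Δ p (insert e E) ≤
          odds Δ p * ∑ E ∈ (F ∪ G).powerset, weight Δ p E := by
        rw [Finset.mul_sum]
        refine Finset.sum_le_sum fun E hE => weight_insert_le Δ p (hG e (by simp)) ?_
        exact fun h => heFG (Finset.mem_powerset.1 hE h)
      nlinarith

/-- Isolating the vertices of `S` costs at most a constant factor per vertex. -/
lemma partition_le_partition_sdiff (Δ p : ℕ) (A S : Finset U) :
    partition Δ p A ≤ (1 + odds Δ p) ^ (S.card * A.card) * partition Δ p (A \ S) := by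
  -- The possible edges with an end in `S`: these are the ones to be forbidden.
  set G := ((S ×ˢ A).image fun q => s(q.1, q.2)).filter fun e => ¬ e.IsDiag with hG
  have hsub : pairs A ⊆ pairs (A \ S) ∪ G := by
    intro e he
    induction e using Sym2.ind with | _ u v =>
    rw [mk_mem_pairs] at he
    by_cases hu : u ∈ S
    · refine Finset.mem_union_right _ (Finset.mem_filter.2 ⟨?_, by simpa using he.2⟩)
      exact Finset.mem_image.2 ⟨(u, v), by simp [hu, he.1], rfl⟩
    · by_cases hv : v ∈ S
      · refine Finset.mem_union_right _ (Finset.mem_filter.2 ⟨?_, by simpa using he.2⟩)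
        exact Finset.mem_image.2 ⟨(v, u), by simp [hv, he.1], Sym2.eq_swap⟩
      · refine Finset.mem_union_left _ ?_
        rw [mk_mem_pairs]
        simp [hu, hv, he]
  have hcard : G.card ≤ S.card * A.card := by
    refine (Finset.card_filter_le _ _).trans (Finset.card_image_le.trans ?_)
    rw [Finset.card_product]
  calc partition Δ p A ≤ ∑ E ∈ (pairs (A \ S) ∪ G).powerset, weight Δ p E :=
        Finset.sum_le_sum_of_subset_of_nonneg (Finset.powerset_mono.2 hsub)
          fun _ _ _ => weight_nonneg _ _ _
    _ ≤ _ := sum_weight_union_le Δ p G (by simp [hG])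
    _ ≤ _ := by
      refine mul_le_mul ?_ le_rfl (partition_pos _ _ _).le (by have := odds_nonneg Δ p; positivity)
      exact pow_le_pow_right₀ (by linarith [odds_nonneg Δ p]) hcard

/-- Each unit step of the base multiplies the rising factorial by `(p + j + 1 + e) / (p + j + 1)`,
which is at most `(p + e) / p`. -/
lemma ascFactorial_shift_le (p j e : ℕ) :
    (p + j + 1).ascFactorial e * p ^ j ≤ (p + 1).ascFactorial e * (p + e) ^ j := by
  induction j with
  | zero => simp
  | succ j ih =>
    have h1 : (p + (j + 1) + 1).ascFactorial e * (p + j + 1) =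
        (p + j + 1).ascFactorial e * (p + j + 1 + e) := by
      have := Nat.succ_ascFactorial (p + j + 1) e
      simp only [Nat.succ_eq_add_one] at this
      rw [show p + (j + 1) + 1 = p + j + 1 + 1 by ring]
      linarith
    have h2 : (p + j + 1 + e) * p ≤ (p + j + 1) * (p + e) := by nlinarith
    have h3 : (p + (j + 1) + 1).ascFactorial e * p ≤ (p + j + 1).ascFactorial e * (p + e) := by
      have : (p + (j + 1) + 1).ascFactorial e * p * (p + j + 1) ≤
          (p + j + 1).ascFactorial e * (p + e) * (p + j + 1) := by
        calc _ = ((p + (j + 1) + 1).ascFactorial e * (p + j + 1)) * p := by ring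
          _ = (p + j + 1).ascFactorial e * ((p + j + 1 + e) * p) := by rw [h1]; ring
          _ ≤ (p + j + 1).ascFactorial e * ((p + j + 1) * (p + e)) := Nat.mul_le_mul_left _ h2
          _ = _ := by ring
      exact Nat.le_of_mul_le_mul_right this (by omega)
    calc _ = ((p + (j + 1) + 1).ascFactorial e * p) * p ^ j := by ring
      _ ≤ ((p + j + 1).ascFactorial e * (p + e)) * p ^ j := Nat.mul_le_mul_right _ h3
      _ = ((p + j + 1).ascFactorial e * p ^ j) * (p + e) := by ring
      _ ≤ ((p + 1).ascFactorial e * (p + e) ^ j) * (p + e) := Nat.mul_le_mul_right _ ih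
      _ = _ := by ring

/-- Shifting `p` changes the total weight by little. -/
lemma partition_shift (Δ p j : ℕ) (hp : 0 < p) (A : Finset U) {M : ℕ} (hM : A.card * Δ ≤ M) :
    ((p : ℝ) / (p + M)) ^ j * partition Δ p A ≤ partition Δ (p + j) A := by
  unfold partition
  rw [Finset.mul_sum]
  refine Finset.sum_le_sum fun E hE => ?_
  by_cases h0 : weight Δ p E = 0
  · rw [h0, mul_zero]; exact weight_nonneg _ _ _
  have hc := card_mul_two_le_of_weight_ne_zero (Finset.mem_powerset.1 hE) h0
  have hp' : (0 : ℝ) < p := by exact_mod_cast hp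
  have hcM : (E.card : ℝ) ≤ M := by exact_mod_cast (by omega : E.card ≤ M)
  have h1 : ((p + j + 1).ascFactorial E.card : ℝ) * (p : ℝ) ^ j ≤
      ((p + 1).ascFactorial E.card : ℝ) * ((p : ℝ) + M) ^ j := by
    calc _ ≤ ((p + 1).ascFactorial E.card : ℝ) * ((p : ℝ) + E.card) ^ j := by
          exact_mod_cast ascFactorial_shift_le p j E.card
      _ ≤ _ := by gcongr
  unfold weight
  rw [div_pow, div_mul_div_comm, div_le_div_iff₀ (by positivity) (by positivity)]
  have hP : (0 : ℝ) ≤ (∏ v, (Δ.descFactorial (deg E v) : ℝ)) * 2 ^ E.card := by positivity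
  nlinarith [mul_le_mul_of_nonneg_left h1 hP]

/-- The degrees sum to `2 * K.card`. Each factor above is at least `Δ - K.card` and each rising
factor below is at most `p + K.card`. -/
lemma le_weight (Δ p : ℕ) {A : Finset U} {K : Finset (Sym2 U)} (hK : K ⊆ pairs A) :
    (((Δ - K.card : ℕ) : ℝ) ^ 2 / (2 * (p + K.card))) ^ K.card ≤ weight Δ p K := by
  unfold weight
  rw [div_pow, mul_pow]
  have h1 : (((p + 1).ascFactorial K.card : ℕ) : ℝ) ≤ ((p : ℝ) + K.card) ^ K.card := by
    exact_mod_cast Nat.ascFactorial_le_pow_add p K.card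
  have h2 : ((((Δ - K.card : ℕ) : ℝ)) ^ 2) ^ K.card ≤
      ∏ v, (Δ.descFactorial (deg K v) : ℝ) := by
    rw [← pow_mul, ← sum_deg hK, ← Finset.prod_pow_eq_pow_sum]
    refine Finset.prod_le_prod (fun _ _ => by positivity) fun v _ => ?_
    have := Nat.pow_sub_le_descFactorial Δ (deg K v)
    have h3 : (Δ - K.card) ^ deg K v ≤ (Δ + 1 - deg K v) ^ deg K v :=
      Nat.pow_le_pow_left (by have := deg_le_card K v; omega) _
    exact_mod_cast h3.trans this
  have h4 : (0 : ℝ) < ((p + 1).ascFactorial K.card : ℕ) := by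
    exact_mod_cast Nat.ascFactorial_pos p K.card
  gcongr

end HubGraph

/-! ### Components, successive explorations and large hub degrees -/

namespace HubGraph

variable {U : Type*} [DecidableEq U] [Fintype U]

/-- The vertices that can be reached from `v` along edges in `E`. -/
noncomputable def reach (E : Finset (Sym2 U)) (v : U) : Finset U :=
  open Classical in
  Finset.univ.filter fun u => Relation.ReflTransGen (fun a b => s(a, b) ∈ E) v u

lemma mem_reach {E : Finset (Sym2 U)} {u v : U} :
    u ∈ reach E v ↔ Relation.ReflTransGen (fun a b => s(a, b) ∈ E) v u := by
  simp [reach]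

lemma self_mem_reach (E : Finset (Sym2 U)) (v : U) : v ∈ reach E v :=
  mem_reach.2 .refl

lemma reach_mono {E F : Finset (Sym2 U)} (h : E ⊆ F) (v : U) : reach E v ⊆ reach F v := by
  intro u hu
  rw [mem_reach] at *
  induction hu with
  | refl => exact .refl
  | tail _ h2 ih => exact ih.tail (h h2)

lemma mem_reach_of_mem {E : Finset (Sym2 U)} {a b v : U} (ha : a ∈ reach E v)
    (hab : s(a, b) ∈ E) : b ∈ reach E v := by
  rw [mem_reach] at *
  exact ha.tail hab

lemma reach_subset {E : Finset (Sym2 U)} {v : U} {S : Finset U} (hv : v ∈ S)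
    (hS : ∀ a b, a ∈ S → a ∈ reach E v → s(a, b) ∈ E → b ∈ S) : reach E v ⊆ S := by
  intro u hu
  rw [mem_reach] at hu
  induction hu with
  | refl => exact hv
  | tail h1 h2 ih => exact hS _ _ ih (mem_reach.2 h1) h2

/-- All edges of `K` lie in the component of `v`. -/
def Rooted (K : Finset (Sym2 U)) (v : U) : Prop := K ⊆ pairs (reach K v)

lemma reach_subset_of_subset_pairs {E : Finset (Sym2 U)} {A : Finset U} (hE : E ⊆ pairs A) {v : U}
    (hv : v ∈ A) : reach E v ⊆ A :=
  reach_subset hv fun _ _ _ _ hab => (mk_mem_pairs.1 (hE hab)).1.2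

/-- Edges that avoid the component of `v` cannot enlarge it. This makes the decomposition by
components a bijection. -/
lemma reach_union {K E : Finset (Sym2 U)} {v : U} {A : Finset U}
    (hE : E ⊆ pairs (A \ reach K v)) : reach (K ∪ E) v = reach K v := by
  refine subset_antisymm ?_ (reach_mono Finset.subset_union_left v)
  refine reach_subset (self_mem_reach _ _) fun a b ha _ hab => ?_
  rcases Finset.mem_union.1 hab with h | h
  · exact mem_reach_of_mem ha h
  · have := (mk_mem_pairs.1 (hE h)).1.1
    simp [ha] at this

lemma reach_inter_pairs_reach {E : Finset (Sym2 U)} {A : Finset U} (hE : E ⊆ pairs A) (v : U) :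
    reach (E ∩ pairs (reach E v)) v = reach E v := by
  refine subset_antisymm (reach_mono Finset.inter_subset_left v) ?_
  refine reach_subset (self_mem_reach _ _) fun a b ha ha' hab => ?_
  refine mem_reach_of_mem ha (Finset.mem_inter.2 ⟨hab, mk_mem_pairs.2 ⟨⟨ha', ?_⟩, ?_⟩⟩)
  · exact mem_reach_of_mem ha' hab
  · exact (mk_mem_pairs.1 (hE hab)).2

lemma eq_union_of_reach {E : Finset (Sym2 U)} {A : Finset U} (hE : E ⊆ pairs A) (v : U) :
    E = (E ∩ pairs (reach E v)) ∪ (E ∩ pairs (A \ reach E v)) := by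
  rw [← Finset.inter_union_distrib_left]
  symm
  rw [Finset.inter_eq_left]
  intro e he
  have heA := hE he
  induction e using Sym2.ind with | _ a b =>
  rw [Finset.mem_union, mk_mem_pairs, mk_mem_pairs]
  rw [mk_mem_pairs] at heA
  by_cases ha : a ∈ reach E v
  · left
    exact ⟨⟨ha, mem_reach_of_mem ha he⟩, heA.2⟩
  · right
    have hb : b ∉ reach E v := fun hb => ha (mem_reach_of_mem hb (by rwa [Sym2.eq_swap]))
    simp [ha, hb, heA]

open Classical in
/-- Summation over edge sets in `A`, sorted by the component of `v`. -/
lemma sum_powerset_eq_sum_rooted {A : Finset U} {v : U}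
    (φ : Finset (Sym2 U) → ℝ) :
    ∑ E ∈ (pairs A).powerset, φ E =
      ∑ K ∈ (pairs A).powerset.filter (fun K => Rooted K v),
        ∑ E ∈ (pairs (A \ reach K v)).powerset, φ (K ∪ E) := by
  rw [Finset.sum_sigma']
  refine Finset.sum_bij' (fun E _ => ⟨E ∩ pairs (reach E v), E ∩ pairs (A \ reach E v)⟩)
    (fun q _ => q.1 ∪ q.2) ?_ ?_ ?_ ?_ ?_
  · intro E hE
    rw [Finset.mem_powerset] at hE
    simp only [Finset.mem_sigma, Finset.mem_filter, Finset.mem_powerset]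
    unfold Rooted
    rw [reach_inter_pairs_reach hE]
    exact ⟨⟨Finset.inter_subset_left.trans hE, Finset.inter_subset_right⟩,
      Finset.inter_subset_right⟩
  · rintro ⟨K, E⟩ h
    simp only [Finset.mem_sigma, Finset.mem_filter, Finset.mem_powerset] at h ⊢
    exact Finset.union_subset h.1.1 (h.2.trans (pairs_mono Finset.sdiff_subset))
  · intro E hE
    exact (eq_union_of_reach (Finset.mem_powerset.1 hE) v).symm
  · rintro ⟨K, E⟩ h
    simp only [Finset.mem_sigma, Finset.mem_filter, Finset.mem_powerset] at h
    have hr := reach_union h.2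
    have hd : Disjoint (pairs (reach K v)) (pairs (A \ reach K v)) :=
      disjoint_pairs Finset.disjoint_sdiff
    have h1 : (K ∪ E) ∩ pairs (reach K v) = K := by
      rw [Finset.union_inter_distrib_right, Finset.inter_eq_left.2 h.1.2,
        Finset.disjoint_iff_inter_eq_empty.1 (Finset.disjoint_of_subset_left h.2 hd.symm),
        Finset.union_empty]
    have h2 : (K ∪ E) ∩ pairs (A \ reach K v) = E := by
      rw [Finset.union_inter_distrib_right, Finset.inter_eq_left.2 h.2,
        Finset.disjoint_iff_inter_eq_empty.1 (Finset.disjoint_of_subset_left h.1.2 hd),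
        Finset.empty_union]
    simp only [hr, h1, h2]
  · intro E hE
    rw [← eq_union_of_reach (Finset.mem_powerset.1 hE) v]

open Classical in
-- The Markov property of the exploration: given the component `K` of `v`, what remains is again a
-- weighted hub graph, with `p` raised by the number of edges of `K`.
lemma partition_eq_sum_rooted (Δ p : ℕ) (A : Finset U) (v : U) :
    partition Δ p A = ∑ K ∈ (pairs A).powerset.filter (fun K => Rooted K v),
      weight Δ p K * partition Δ (p + K.card) (A \ reach K v) := by
  unfold partition
  rw [sum_powerset_eq_sum_rooted (v := v)]
  refine Finset.sum_congr rfl fun K hK => ?_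
  rw [Finset.mem_filter] at hK
  rw [Finset.mul_sum]
  refine Finset.sum_congr rfl fun E hE => ?_
  exact weight_union Δ p Finset.disjoint_sdiff hK.2 (Finset.mem_powerset.1 hE)

open Classical in
/-- The total weight of the hub graphs on `A` all of whose components have order less than `k`. -/
noncomputable def smallPartition (k Δ p : ℕ) (A : Finset U) : ℝ :=
  ∑ E ∈ (pairs A).powerset.filter (fun E => ∀ v, (reach E v).card < k), weight Δ p E

lemma smallPartition_le (k Δ p : ℕ) (A : Finset U) : smallPartition k Δ p A ≤ partition Δ p A :=
  Finset.sum_le_sum_of_subset_of_nonneg (Finset.filter_subset _ _) fun _ _ _ => weight_nonneg _ _ _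

open Classical in
/-- The total weight of the hub graphs on `A` in which the component of `v` has order at
least `k`. -/
noncomputable def largeWeight (k Δ p : ℕ) (A : Finset U) (v : U) : ℝ :=
  ∑ K ∈ (pairs A).powerset.filter (fun K => Rooted K v ∧ k ≤ (reach K v).card),
      weight Δ p K * partition Δ (p + K.card) (A \ reach K v)

/-- If each exploration from a vertex finds a component of order at least `k` with probability
at least `q`, then `t` explorations all fail with probability at most `(1 - q) ^ t`. -/
lemma smallPartition_le_pow {k Δ a p₀ P : ℕ} {q : ℝ} {H : Finset U} (hq : q ≤ 1)
    (hlarge : ∀ A ⊆ H, a ≤ A.card → ∀ p, p₀ ≤ p → p ≤ P → ∀ v ∈ A,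
      q * partition Δ p A ≤ largeWeight k Δ p A v) (hk : 0 < k) :
    ∀ t : ℕ, ∀ A ⊆ H, a + t * k ≤ A.card → ∀ p, p₀ ≤ p → p + t * k ^ 2 ≤ P →
      smallPartition k Δ p A ≤ (1 - q) ^ t * partition Δ p A := by
  classical
  intro t
  induction t with
  | zero => intro A _ _ p _ _; simpa using smallPartition_le k Δ p A
  | succ t ih =>
    intro A hA hcard p hp hpP
    obtain ⟨v, hv⟩ : A.Nonempty := by
      rw [← Finset.card_pos]
      nlinarith
    -- If the component of `v` has order at least `k`, the graph does not count. Otherwise the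
    -- components outside it must be small as well.
    have h1 : smallPartition k Δ p A ≤
        ∑ K ∈ (pairs A).powerset.filter (fun K => Rooted K v ∧ ¬ k ≤ (reach K v).card),
          weight Δ p K * smallPartition k Δ (p + K.card) (A \ reach K v) := by
      unfold smallPartition
      rw [Finset.sum_filter, sum_powerset_eq_sum_rooted (v := v)]
      rw [← Finset.filter_filter, Finset.sum_filter (s := (pairs A).powerset.filter _)]
      refine Finset.sum_le_sum fun K hK => ?_
      rw [Finset.mem_filter] at hK
      split_ifs with hsm
      · refine Finset.sum_nonpos fun E hE => ?_
        rw [if_neg]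
        intro h
        exact absurd hsm (not_le.2 ((Finset.card_le_card
          (reach_mono Finset.subset_union_left v)).trans_lt (h v)))
      · rw [Finset.mul_sum, Finset.sum_filter]
        refine Finset.sum_le_sum fun E hE => ?_
        rw [weight_union Δ p Finset.disjoint_sdiff hK.2 (Finset.mem_powerset.1 hE)]
        split_ifs with h2 h3 h3
        · exact le_rfl
        · exact absurd (fun u => (Finset.card_le_card
            (reach_mono Finset.subset_union_right u)).trans_lt (h2 u)) h3
        · exact mul_nonneg (weight_nonneg _ _ _) (weight_nonneg _ _ _)
        · exact le_rfl
    have h2 : ∑ K ∈ (pairs A).powerset.filter (fun K => Rooted K v ∧ ¬ k ≤ (reach K v).card),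
          weight Δ p K * smallPartition k Δ (p + K.card) (A \ reach K v) ≤
        ∑ K ∈ (pairs A).powerset.filter (fun K => Rooted K v ∧ ¬ k ≤ (reach K v).card),
          (1 - q) ^ t * (weight Δ p K * partition Δ (p + K.card) (A \ reach K v)) := by
      refine Finset.sum_le_sum fun K hK => ?_
      simp only [Finset.mem_filter, not_le] at hK
      -- A failed exploration reveals fewer than `k` hubs, hence at most `k ^ 2` edges. This is the
      -- amount by which `p` may grow per round.
      have hKc : K.card ≤ k ^ 2 := by
        calc K.card ≤ _ := Finset.card_le_card hK.2.1
          _ ≤ (reach K v).card ^ 2 := card_pairs_le _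
          _ ≤ _ := Nat.pow_le_pow_left hK.2.2.le 2
      have hc : A.card ≤ (A \ reach K v).card + (reach K v).card := by
        have := Finset.le_card_sdiff (reach K v) A
        omega
      have := ih (A \ reach K v) (Finset.sdiff_subset.trans hA) (by nlinarith) (p + K.card)
        (by omega) (by nlinarith)
      calc _ ≤ weight Δ p K * ((1 - q) ^ t * partition Δ (p + K.card) (A \ reach K v)) :=
            mul_le_mul_of_nonneg_left this (weight_nonneg _ _ _)
        _ = _ := by ring
    have h3 := hlarge A hA (by nlinarith) p hp (by nlinarith) v hv
    have h4 : partition Δ p A = largeWeight k Δ p A v +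
        ∑ K ∈ (pairs A).powerset.filter (fun K => Rooted K v ∧ ¬ k ≤ (reach K v).card),
          weight Δ p K * partition Δ (p + K.card) (A \ reach K v) := by
      rw [partition_eq_sum_rooted Δ p A v, largeWeight, ← Finset.filter_filter,
        ← Finset.filter_filter, Finset.sum_filter_add_sum_filter_not]
    rw [← Finset.mul_sum] at h2
    refine (h1.trans h2).trans ?_
    rw [pow_succ, mul_assoc]
    exact mul_le_mul_of_nonneg_left (by linarith) (pow_nonneg (by linarith) t)

/-- Large degrees are unlikely. -/
lemma sum_weight_deg_ge_le (Δ p r : ℕ) (A : Finset U) (v : U) :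
    ∑ E ∈ (pairs A).powerset.filter (fun E => r ≤ deg E v), weight Δ p E ≤
      (A.card * odds Δ p) ^ r * partition Δ p A := by
  classical
  -- Union bound over the `r`-sets `F` of possible edges at `v`: deleting `F` from a graph
  -- containing it costs a factor `odds Δ p ^ r`.
  set T := (A.erase v).image (fun u => s(v, u)) with hT
  have hTd : ∀ e ∈ T, ¬ e.IsDiag := by
    intro e he
    obtain ⟨u, hu, rfl⟩ := Finset.mem_image.1 he
    simpa using (Finset.ne_of_mem_erase hu).symm
  have hTc : T.card ≤ A.card :=
    Finset.card_image_le.trans (Finset.card_le_card (Finset.erase_subset _ _))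
  have ho := odds_nonneg Δ p
  calc _ ≤ ∑ E ∈ (pairs A).powerset.filter (fun E => r ≤ deg E v),
        ∑ F ∈ T.powersetCard r, if F ⊆ E then weight Δ p E else 0 := by
        refine Finset.sum_le_sum fun E hE => ?_
        rw [Finset.mem_filter, Finset.mem_powerset] at hE
        obtain ⟨F, hF, hFr⟩ := Finset.exists_subset_card_eq hE.2
        have hFE : F ⊆ E := hF.trans (Finset.filter_subset _ _)
        have hFT : F ∈ T.powersetCard r := by
          refine Finset.mem_powersetCard.2 ⟨fun e he => ?_, hFr⟩
          obtain ⟨u, rfl⟩ := (Finset.mem_filter.1 (hF he)).2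
          have := mk_mem_pairs.1 (hE.1 (hFE he))
          exact Finset.mem_image.2 ⟨u, by simp [this.1, this.2.symm], rfl⟩
        refine le_trans ?_ (Finset.single_le_sum (f := fun F => if F ⊆ E then weight Δ p E else 0)
          (fun F _ => ?_) hFT)
        · simp [hFE]
        · split_ifs
          exacts [weight_nonneg _ _ _, le_rfl]
    _ ≤ ∑ E ∈ (pairs A).powerset,
        ∑ F ∈ T.powersetCard r, if F ⊆ E then weight Δ p E else 0 :=
        Finset.sum_le_sum_of_subset_of_nonneg (Finset.filter_subset _ _) fun E _ _ =>
          Finset.sum_nonneg fun F _ => by split_ifs; exacts [weight_nonneg _ _ _, le_rfl]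
    _ = ∑ F ∈ T.powersetCard r, ∑ E ∈ (pairs A).powerset.filter (fun E => F ⊆ E),
          weight Δ p E := by
        rw [Finset.sum_comm]
        simp_rw [Finset.sum_filter]
    _ ≤ ∑ F ∈ T.powersetCard r, odds Δ p ^ r * partition Δ p A := by
        refine Finset.sum_le_sum fun F hF => ?_
        rw [Finset.mem_powersetCard] at hF
        calc _ ≤ ∑ E ∈ (pairs A).powerset.filter (fun E => F ⊆ E),
              odds Δ p ^ r * weight Δ p (E \ F) := by
              refine Finset.sum_le_sum fun E hE => ?_
              rw [Finset.mem_filter] at hE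
              have := weight_union_le Δ p (E := E \ F) (F := F) (fun e he => hTd e (hF.1 he))
                Finset.sdiff_disjoint
              rwa [Finset.sdiff_union_of_subset hE.2, hF.2] at this
          _ = odds Δ p ^ r * ∑ E ∈ ((pairs A).powerset.filter (fun E => F ⊆ E)).image (· \ F),
                weight Δ p E := by
              rw [Finset.mul_sum, Finset.sum_image]
              intro E hE E' hE' h
              simp only [Finset.coe_filter, Set.mem_ofPred_eq] at hE hE'
              simp only at h
              rw [← Finset.sdiff_union_of_subset hE.2, h, Finset.sdiff_union_of_subset hE'.2]
          _ ≤ _ := by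
              refine mul_le_mul_of_nonneg_left ?_ (by positivity)
              refine Finset.sum_le_sum_of_subset_of_nonneg ?_ fun _ _ _ => weight_nonneg _ _ _
              intro E hE
              obtain ⟨E', hE', rfl⟩ := Finset.mem_image.1 hE
              rw [Finset.mem_filter, Finset.mem_powerset] at hE'
              exact Finset.mem_powerset.2 (Finset.sdiff_subset.trans hE'.1)
    _ ≤ _ := by
        rw [Finset.sum_const, nsmul_eq_mul, Finset.card_powersetCard, mul_pow, mul_assoc]
        refine mul_le_mul_of_nonneg_right ?_
          (mul_nonneg (by positivity) (partition_pos _ _ _).le)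
        calc (T.card.choose r : ℝ) ≤ (T.card : ℝ) ^ r := by
              exact_mod_cast Nat.choose_le_pow T.card r
          _ ≤ _ := by
              have : (T.card : ℝ) ≤ A.card := by exact_mod_cast hTc
              gcongr

end HubGraph

/-! ### Layered forests and the probability of a large component -/

namespace HubGraph

variable {U : Type*} [DecidableEq U] [Fintype U]

/-- The sets of edges joining each vertex of `L'` to exactly one vertex of `L`. -/
def attachments (L L' : Finset U) : Finset (Finset (Sym2 U)) :=
  (Fintype.piFinset fun u => if u ∈ L' then L else {u}).image fun f => L'.image fun u => s(u, f u)

lemma mem_attachments {L L' : Finset U} {F : Finset (Sym2 U)} :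
    F ∈ attachments L L' ↔
      ∃ f : U → U, (∀ u, f u ∈ if u ∈ L' then L else {u}) ∧ L'.image (fun u => s(u, f u)) = F := by
  simp [attachments]

lemma mk_mem_attachment {L L' : Finset U} (hd : Disjoint L L') {f : U → U}
    {u w : U} (hu : u ∉ L) (hw : w ∈ L) :
    s(u, w) ∈ L'.image (fun u => s(u, f u)) ↔ u ∈ L' ∧ f u = w := by
  simp only [Finset.mem_image]
  constructor
  · rintro ⟨a, ha, h⟩
    rcases Sym2.eq_iff.1 h with ⟨rfl, rfl⟩ | ⟨rfl, rfl⟩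
    · exact ⟨ha, rfl⟩
    · exact absurd ha (Finset.disjoint_left.1 hd hw)
  · rintro ⟨h, rfl⟩
    exact ⟨u, h, rfl⟩

/-- As `L` and `L'` are disjoint, each edge shows which end is the child, so `f` can be read off
from the edge set. -/
lemma card_attachments {L L' : Finset U} (hd : Disjoint L L') :
    (attachments L L').card = L.card ^ L'.card := by
  unfold attachments
  rw [Finset.card_image_of_injOn, Fintype.card_piFinset]
  · have : ∀ u, (if u ∈ L' then L else {u}).card = if u ∈ L' then L.card else 1 := by
      intro u; split_ifs <;> simp
    simp_rw [this]
    rw [Finset.prod_ite_mem, Finset.univ_inter, Finset.prod_const]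
  · intro f hf g hg hfg
    simp only [Finset.mem_coe, Fintype.mem_piFinset] at hf hg
    simp only at hfg
    funext u
    by_cases hu : u ∈ L'
    · have huL := Finset.disjoint_right.1 hd hu
      have hfu : f u ∈ L := by simpa [hu] using hf u
      have h1 := (mk_mem_attachment hd huL hfu).2 ⟨hu, rfl⟩
      rw [hfg, mk_mem_attachment hd huL hfu] at h1
      exact h1.2.symm
    -- Outside `L'` the only admissible value of `f` is `u` itself, so irrelevant values are not
    -- counted.
    · have h1 := hf u
      have h2 := hg u
      simp only [hu, if_false, Finset.mem_singleton] at h1 h2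
      rw [h1, h2]

lemma card_of_mem_attachments {L L' : Finset U} (hd : Disjoint L L') {F : Finset (Sym2 U)}
    (hF : F ∈ attachments L L') : F.card = L'.card := by
  obtain ⟨f, hf, rfl⟩ := mem_attachments.1 hF
  apply Finset.card_image_of_injOn
  intro a ha b hb hab
  rcases Sym2.eq_iff.1 hab with ⟨h, -⟩ | ⟨h, -⟩
  · exact h
  · have := hf b
    rw [if_pos (by exact hb), ← h] at this
    exact absurd ha (Finset.disjoint_left.1 hd this)

lemma attachment_subset {L L' : Finset U} (hd : Disjoint L L') {F : Finset (Sym2 U)}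
    (hF : F ∈ attachments L L') : F ⊆ pairs (L ∪ L') := by
  obtain ⟨f, hf, rfl⟩ := mem_attachments.1 hF
  intro e he
  obtain ⟨u, hu, rfl⟩ := Finset.mem_image.1 he
  have h := hf u
  rw [if_pos hu] at h
  rw [mk_mem_pairs]
  refine ⟨⟨by simp [hu], by simp [h]⟩, ?_⟩
  rintro h2
  exact Finset.disjoint_left.1 hd h (h2 ▸ hu)

lemma disjoint_attachment {L L' A : Finset U} (hLA : Disjoint L A) {F : Finset (Sym2 U)}
    (hF : F ∈ attachments L L') : Disjoint F (pairs A) := by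
  obtain ⟨f, hf, rfl⟩ := mem_attachments.1 hF
  rw [Finset.disjoint_left]
  intro e he he'
  obtain ⟨u, hu, rfl⟩ := Finset.mem_image.1 he
  have h := hf u
  rw [if_pos hu] at h
  exact Finset.disjoint_left.1 hLA h (mk_mem_pairs.1 he').1.2

/-- The edge sets of forests which grow in `h` layers of `b` vertices of `A` each from the initial
layer `L`, every vertex being attached to the preceding layer. -/
def layered (b : ℕ) : ℕ → Finset U → Finset U → Finset (Finset (Sym2 U))
  | 0, _, _ => {∅}
  | h + 1, L, A => (A.powersetCard b).biUnion fun L' =>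
      (attachments L L').biUnion fun F => (layered b h L' (A \ L')).image fun K => F ∪ K

lemma mem_layered_succ {b h : ℕ} {L A : Finset U} {K : Finset (Sym2 U)} :
    K ∈ layered b (h + 1) L A ↔ ∃ L' ⊆ A, L'.card = b ∧ ∃ F ∈ attachments L L',
      ∃ K' ∈ layered b h L' (A \ L'), F ∪ K' = K := by
  simp [layered, Finset.mem_powersetCard, and_assoc]

/-- Every new vertex brings exactly one edge, to its parent. For `L = {v}` the forest is thus a tree
that spans `v` and the `b * h` new vertices. -/
lemma layered_spec {b : ℕ} : ∀ (h : ℕ) {L A : Finset U} {K : Finset (Sym2 U)}, Disjoint L A →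
    K ∈ layered b h L A → K.card = b * h ∧ ∃ S ⊆ A, S.card = b * h ∧ K ⊆ pairs (L ∪ S) ∧
      ∀ u ∈ S, ∃ w ∈ L, u ∈ reach K w := by
  intro h
  induction h with
  | zero =>
    intro L A K _ hK
    simp only [layered, Finset.mem_singleton] at hK
    subst hK
    exact ⟨by simp, ∅, by simp⟩
  | succ h ih =>
    intro L A K hd hK
    obtain ⟨L', hL', hcL', F, hF, K', hK', rfl⟩ := mem_layered_succ.1 hK
    obtain ⟨h1, S, hSA, hSc, hKS, hreach⟩ := ih Finset.disjoint_sdiff hK'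
    have hdL : Disjoint L L' := Finset.disjoint_of_subset_right hL' hd
    have hLS : L' ∪ S ⊆ A := Finset.union_subset hL' (hSA.trans Finset.sdiff_subset)
    have hFK : Disjoint F K' := Finset.disjoint_of_subset_right (hKS.trans (pairs_mono hLS))
      (disjoint_attachment hd hF)
    have hL'S : Disjoint L' S := Finset.disjoint_of_subset_right hSA Finset.disjoint_sdiff
    refine ⟨?_, L' ∪ S, hLS, ?_, ?_, ?_⟩
    · rw [Finset.card_union_of_disjoint hFK, card_of_mem_attachments hdL hF, h1, hcL']
      ring
    · rw [Finset.card_union_of_disjoint hL'S, hcL', hSc]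
      ring
    · refine Finset.union_subset ((attachment_subset hdL hF).trans (pairs_mono ?_))
        (hKS.trans (pairs_mono ?_))
      · rw [← Finset.union_assoc]
        exact Finset.subset_union_left
      · exact Finset.subset_union_right
    · have hbase : ∀ u ∈ L', ∃ w ∈ L, u ∈ reach (F ∪ K') w := by
        intro u hu
        obtain ⟨f, hf, rfl⟩ := mem_attachments.1 hF
        have h := hf u
        rw [if_pos hu] at h
        refine ⟨f u, h, mem_reach_of_mem (self_mem_reach _ _) (Finset.mem_union_left _ ?_)⟩
        exact Finset.mem_image.2 ⟨u, hu, Sym2.eq_swap⟩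
      intro u hu
      rcases Finset.mem_union.1 hu with hu | hu
      · exact hbase u hu
      · obtain ⟨w', hw', hr⟩ := hreach u hu
        obtain ⟨w, hw, hr'⟩ := hbase w' hw'
        refine ⟨w, hw, ?_⟩
        have hr := reach_mono (Finset.subset_union_right (s₁ := F)) _ hr
        rw [mem_reach] at *
        exact hr'.trans hr

lemma layered_subset {b h : ℕ} {L A : Finset U} {K : Finset (Sym2 U)} (hd : Disjoint L A)
    (hK : K ∈ layered b h L A) : K ⊆ pairs (L ∪ A) := by
  obtain ⟨_, S, hS, _, hKS, _⟩ := layered_spec h hd hK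
  exact hKS.trans (pairs_mono (Finset.union_subset_union_right hS))

/-- No forest is counted twice: `K'` consists of the edges inside `A`, `F` of the others, and `L'`
of the vertices of `A` that `F` joins to `L`. -/
lemma card_layered_succ {b h : ℕ} {L A : Finset U} (hd : Disjoint L A) :
    (layered b (h + 1) L A).card =
      ∑ L' ∈ A.powersetCard b, L.card ^ b * (layered b h L' (A \ L')).card := by
  have hsub : ∀ L' ⊆ A, ∀ K' ∈ layered b h L' (A \ L'), K' ⊆ pairs A := by
    intro L' hL' K' hK'
    have := layered_subset Finset.disjoint_sdiff hK'
    rwa [Finset.union_sdiff_of_subset hL'] at this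
  have hFeq : ∀ {L'}, L' ⊆ A → ∀ {F}, F ∈ attachments L L' → ∀ {K'},
      K' ∈ layered b h L' (A \ L') → (F ∪ K') \ pairs A = F := by
    intro L' hL' F hF K' hK'
    rw [Finset.union_sdiff_distrib, Finset.sdiff_eq_empty_iff_subset.2 (hsub L' hL' K' hK'),
      Finset.union_empty, Finset.sdiff_eq_self_of_disjoint (disjoint_attachment hd hF)]
  have hKeq : ∀ {L'}, L' ⊆ A → ∀ {F}, F ∈ attachments L L' → ∀ {K'},
      K' ∈ layered b h L' (A \ L') → (F ∪ K') ∩ pairs A = K' := by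
    intro L' hL' F hF K' hK'
    rw [Finset.union_inter_distrib_right, Finset.inter_eq_left.2 (hsub L' hL' K' hK'),
      Finset.disjoint_iff_inter_eq_empty.1 (disjoint_attachment hd hF), Finset.empty_union]
  have hLeq : ∀ {L'}, L' ⊆ A → ∀ {F}, F ∈ attachments L L' →
      A.filter (fun u => ∃ w ∈ L, s(u, w) ∈ F) = L' := by
    intro L' hL' F hF
    obtain ⟨f, hf, rfl⟩ := mem_attachments.1 hF
    have hdL : Disjoint L L' := Finset.disjoint_of_subset_right hL' hd
    ext u
    rw [Finset.mem_filter]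
    constructor
    · rintro ⟨hu, w, hw, h⟩
      exact ((mk_mem_attachment hdL (Finset.disjoint_right.1 hd hu) hw).1 h).1
    · intro hu
      have h := hf u
      rw [if_pos hu] at h
      exact ⟨hL' hu, f u, h, Finset.mem_image.2 ⟨u, hu, rfl⟩⟩
  rw [layered, Finset.card_biUnion]
  · refine Finset.sum_congr rfl fun L' hL' => ?_
    rw [Finset.mem_powersetCard] at hL'
    rw [Finset.card_biUnion]
    · rw [Finset.sum_const_nat (m := (layered b h L' (A \ L')).card), card_attachments
        (Finset.disjoint_of_subset_right hL'.1 hd), hL'.2]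
      intro F hF
      apply Finset.card_image_of_injOn
      intro K hK K' hK' h
      simp only at h
      rw [← hKeq hL'.1 hF hK, h, hKeq hL'.1 hF hK']
    · intro F hF F' hF' hne
      rw [Function.onFun, Finset.disjoint_left]
      intro K hK hK'
      obtain ⟨K1, h1, rfl⟩ := Finset.mem_image.1 hK
      obtain ⟨K2, h2, h3⟩ := Finset.mem_image.1 hK'
      exact hne (by rw [← hFeq hL'.1 hF h1, ← h3, hFeq hL'.1 hF' h2])
  · intro L1 hL1 L2 hL2 hne
    rw [Finset.mem_coe, Finset.mem_powersetCard] at hL1 hL2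
    rw [Function.onFun, Finset.disjoint_left]
    intro K hK hK'
    simp only [Finset.mem_biUnion, Finset.mem_image] at hK hK'
    obtain ⟨F1, hF1, K1, hK1, rfl⟩ := hK
    obtain ⟨F2, hF2, K2, hK2, h⟩ := hK'
    have hF : F1 = F2 := by rw [← hFeq hL1.1 hF1 hK1, ← h, hFeq hL2.1 hF2 hK2]
    subst hF
    exact hne (by rw [← hLeq hL1.1 hF1, hLeq hL2.1 hF2])

/-- Every layer is chosen among at least `a` unused vertices. The first layer has `L.card ^ b`
attachments, each later one `b ^ b`. The factor `b ^ b` on the right avoids the exponent `h - 1`;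
for `h = 0` the claim reduces to `L.card ≤ b`. -/
lemma le_card_layered {b a : ℕ} : ∀ (h : ℕ) {L A : Finset U}, Disjoint L A → L.card ≤ b →
    a + b * h ≤ A.card →
      a.choose b ^ h * L.card ^ b * b ^ (b * h) ≤ b ^ b * (layered b h L A).card := by
  intro h
  induction h with
  | zero =>
    intro L A _ hL _
    simpa [layered] using Nat.pow_le_pow_left hL b
  | succ h ih =>
    intro L A hd hL hA
    rw [card_layered_succ hd, Finset.mul_sum]
    have hterm : ∀ L' ∈ A.powersetCard b, L.card ^ b * (a.choose b ^ h * b ^ b * b ^ (b * h)) ≤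
        b ^ b * (L.card ^ b * (layered b h L' (A \ L')).card) := by
      intro L' hL'
      rw [Finset.mem_powersetCard] at hL'
      have hc : (A \ L').card = A.card - b := by
        rw [Finset.card_sdiff_of_subset hL'.1, hL'.2]
      have h1 := ih (L := L') (A := A \ L') Finset.disjoint_sdiff hL'.2.le
        (by rw [hc]; rw [mul_add] at hA; omega)
      rw [hL'.2] at h1
      calc _ ≤ L.card ^ b * (b ^ b * (layered b h L' (A \ L')).card) := Nat.mul_le_mul_left _ h1
        _ = _ := by ring
    refine le_trans ?_ (Finset.card_nsmul_le_sum _ _ _ hterm)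
    rw [Finset.card_powersetCard, smul_eq_mul]
    have h2 : a.choose b ≤ A.card.choose b := Nat.choose_le_choose b (by omega)
    calc _ = a.choose b * (L.card ^ b * (a.choose b ^ h * b ^ b * b ^ (b * h))) := by ring
      _ ≤ _ := Nat.mul_le_mul_right _ h2

/-- A lower bound for the probability that the component of a given vertex is large. -/
lemma le_largeWeight {b h a Δ p₀ P M : ℕ} {H A : Finset U} {v : U} (hv : v ∈ A)
    (hAH : A ⊆ H) (hb : 1 ≤ b) (hA : a + b * h + 1 ≤ A.card) {p : ℕ} (hp0 : 0 < p₀) (hp : p₀ ≤ p)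
    (hpP : p ≤ P) (hM : H.card * Δ ≤ M) :
    ((a.choose b : ℝ) ^ h * b ^ (b * h) / b ^ b *
      ((((Δ - b * h : ℕ) : ℝ) ^ 2 / (2 * (P + (b * h : ℕ)))) ^ (b * h) *
        (((p₀ : ℝ) / (p₀ + M)) ^ (b * h) / (1 + odds Δ p₀) ^ ((b * h + 1) * H.card)))) *
      partition Δ p A ≤ largeWeight (b * h + 1) Δ p A v := by
  classical
  set j := b * h with hj
  set T := layered b h {v} (A.erase v) with hT
  have hd : Disjoint {v} (A.erase v) := by simp
  have hvA : {v} ∪ A.erase v = A := by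
    rw [← Finset.insert_eq, Finset.insert_erase hv]
  have hspec : ∀ K ∈ T, K.card = j ∧ K ⊆ pairs A ∧ Rooted K v ∧ (reach K v).card = j + 1 := by
    intro K hK
    obtain ⟨h1, S, hS, hSc, hKS, hr⟩ := layered_spec h hd hK
    have hvS : v ∉ S := fun h => by simpa using hS h
    have hsub : {v} ∪ S ⊆ A := by
      rw [← hvA]; exact Finset.union_subset_union_right hS
    have hre : reach K v = {v} ∪ S := by
      apply subset_antisymm
      · exact reach_subset_of_subset_pairs hKS (by simp)
      · intro u hu
        rcases Finset.mem_union.1 hu with hu | hu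
        · rw [Finset.mem_singleton.1 hu]; exact self_mem_reach _ _
        · obtain ⟨w, hw, h2⟩ := hr u hu
          rwa [Finset.mem_singleton.1 hw] at h2
    refine ⟨h1, hKS.trans (pairs_mono hsub), ?_, ?_⟩
    · unfold Rooted; rw [hre]; exact hKS
    · rw [hre, ← Finset.insert_eq, Finset.card_insert_of_notMem hvS, hSc]
  have ho := odds_nonneg Δ p₀
  have hp0' : (0 : ℝ) < p₀ := by exact_mod_cast hp0
  have hpp : (p₀ : ℝ) ≤ p := by exact_mod_cast hp
  have hpP' : (p : ℝ) ≤ P := by exact_mod_cast hpP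
  have hb' : (0 : ℝ) < b := by exact_mod_cast hb
  have hpos : (0 : ℝ) < p := hp0'.trans_le hpp
  have ho' : 0 < 1 + odds Δ p₀ := by linarith
  -- All trees in `T` have the same size, so one bound serves for each: the weight of the tree, the
  -- price of isolating its vertices, and the price of shifting `p`.
  have hterm : ∀ K ∈ T,
      (((Δ - j : ℕ) : ℝ) ^ 2 / (2 * (P + (j : ℕ)))) ^ j *
        (((p₀ : ℝ) / (p₀ + M)) ^ j / (1 + odds Δ p₀) ^ ((j + 1) * H.card)) * partition Δ p A ≤
      weight Δ p K * partition Δ (p + K.card) (A \ reach K v) := by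
    intro K hK
    obtain ⟨h1, h2, h3, h4⟩ := hspec K hK
    have hw := le_weight Δ p h2
    rw [h1] at hw
    have hw' : (((Δ - j : ℕ) : ℝ) ^ 2 / (2 * (P + (j : ℕ)))) ^ j ≤ weight Δ p K := by
      refine le_trans ?_ hw
      gcongr
    rw [h1, mul_assoc]
    refine mul_le_mul hw' ?_ (mul_nonneg (by positivity) (partition_pos _ _ _).le)
      (weight_nonneg _ _ _)
    have hs := partition_shift Δ p j (by omega) (A \ reach K v) (M := M)
      ((Nat.mul_le_mul_right _ (Finset.card_le_card (Finset.sdiff_subset.trans hAH))).trans hM)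
    refine le_trans ?_ hs
    have hi := partition_le_partition_sdiff Δ p A (reach K v)
    rw [h4] at hi
    have hi' : partition Δ p A ≤ (1 + odds Δ p₀) ^ ((j + 1) * H.card) *
        partition Δ p (A \ reach K v) := by
      refine hi.trans (mul_le_mul_of_nonneg_right ?_ (partition_pos _ _ _).le)
      calc _ ≤ (1 + odds Δ p₀) ^ ((j + 1) * A.card) := by
            have := odds_anti Δ hp
            have := odds_nonneg Δ p
            gcongr
        _ ≤ _ := pow_le_pow_right₀ (by linarith)
            (Nat.mul_le_mul_left _ (Finset.card_le_card hAH))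
    have hq : (p₀ : ℝ) / (p₀ + M) ≤ (p : ℝ) / (p + M) := by
      rw [div_le_div_iff₀ (by positivity) (by positivity)]
      nlinarith [(Nat.cast_nonneg M : (0 : ℝ) ≤ M)]
    rw [div_mul_eq_mul_div, div_le_iff₀ (by positivity)]
    calc _ ≤ ((p : ℝ) / (p + M)) ^ j * ((1 + odds Δ p₀) ^ ((j + 1) * H.card) *
        partition Δ p (A \ reach K v)) := by
          have := (partition_pos Δ p A).le
          gcongr
      _ = _ := by ring
  have hcard : (a.choose b : ℝ) ^ h * b ^ j / b ^ b ≤ T.card := by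
    rw [div_le_iff₀ (by positivity)]
    have := le_card_layered (b := b) (a := a) h (L := {v}) (A := A.erase v) hd (by simpa using hb)
      (by rw [Finset.card_erase_of_mem hv]; omega)
    simp only [Finset.card_singleton, one_pow, mul_one] at this
    rw [mul_comm (T.card : ℝ)]
    exact_mod_cast this
  calc _ = ((a.choose b : ℝ) ^ h * b ^ j / b ^ b) *
        ((((Δ - j : ℕ) : ℝ) ^ 2 / (2 * (P + (j : ℕ)))) ^ j *
        (((p₀ : ℝ) / (p₀ + M)) ^ j / (1 + odds Δ p₀) ^ ((j + 1) * H.card)) *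
          partition Δ p A) := by ring
    _ ≤ T.card * _ := by
        refine mul_le_mul_of_nonneg_right hcard (mul_nonneg (by positivity) (partition_pos _ _ _).le)
    _ ≤ ∑ K ∈ T, weight Δ p K * partition Δ (p + K.card) (A \ reach K v) := by
        rw [← nsmul_eq_mul]
        exact Finset.card_nsmul_le_sum _ _ _ hterm
    _ ≤ _ := by
        unfold largeWeight
        refine Finset.sum_le_sum_of_subset_of_nonneg ?_ fun K _ _ =>
          mul_nonneg (weight_nonneg _ _ _) (partition_pos _ _ _).le
        intro K hK
        obtain ⟨h1, h2, h3, h4⟩ := hspec K hK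
        exact Finset.mem_filter.2 ⟨Finset.mem_powerset.2 h2, h3, h4.ge⟩

end HubGraph

/-! ### Counting realizations with a given hub graph by switchings -/

namespace HubGraph

variable {U : Type*} [DecidableEq U] [Fintype U]

/-- The edge sets of the simple graphs with degrees `d`. -/
def edgeRealizations (d : U → ℕ) : Finset (Finset (Sym2 U)) :=
  (pairs Finset.univ).powerset.filter fun D => ∀ v, deg D v = d v

lemma mem_edgeRealizations {d : U → ℕ} {D : Finset (Sym2 U)} :
    D ∈ edgeRealizations d ↔ D ⊆ pairs Finset.univ ∧ ∀ v, deg D v = d v := by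
  simp [edgeRealizations]

/-- The edge sets of the simple graphs with degrees `d` whose set of edges inside `A` is `E`. -/
def extensions (d : U → ℕ) (A : Finset U) (E : Finset (Sym2 U)) : Finset (Finset (Sym2 U)) :=
  (edgeRealizations d).filter fun D => D ∩ pairs A = E

lemma mem_extensions {d : U → ℕ} {A : Finset U} {E D : Finset (Sym2 U)} :
    D ∈ extensions d A E ↔ (D ⊆ pairs Finset.univ ∧ ∀ v, deg D v = d v) ∧ D ∩ pairs A = E := by
  simp [extensions, mem_edgeRealizations]

/-- Every vertex of `A` has degree `Δ`, every other vertex has degree `1`. -/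
structure HubDegrees (d : U → ℕ) (A : Finset U) (Δ : ℕ) : Prop where
  hub : ∀ v ∈ A, d v = Δ
  leaf : ∀ v ∉ A, d v = 1

lemma ne_of_mem_pairs {A : Finset U} {D : Finset (Sym2 U)} (hD : D ⊆ pairs A) {a b : U}
    (h : s(a, b) ∈ D) : a ≠ b := (mk_mem_pairs.1 (hD h)).2

lemma eq_of_deg_eq_one {D : Finset (Sym2 U)} {x : U} (h : deg D x = 1) {e f : Sym2 U}
    (he : e ∈ D) (hf : f ∈ D) (hxe : x ∈ e) (hxf : x ∈ f) : e = f :=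
  Finset.card_le_one.1 h.le e (by simp [he, hxe]) f (by simp [hf, hxf])

section
variable {d : U → ℕ} {A : Finset U} {Δ : ℕ} {E D : Finset (Sym2 U)}

lemma card_hub_neighbors (hD : D ∈ extensions d A E) {u : U} (hu : u ∈ A) :
    (A.filter fun w => s(u, w) ∈ D).card = deg E u := by
  obtain ⟨⟨h1, -⟩, rfl⟩ := mem_extensions.1 hD
  rw [deg_eq_card_adj _ A u]
  · congr 1
    ext w
    simp only [Finset.mem_filter, Finset.mem_inter, mk_mem_pairs]
    constructor
    · rintro ⟨hw, h⟩
      exact ⟨hw, h, ⟨hu, hw⟩, ne_of_mem_pairs h1 h⟩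
    · rintro ⟨hw, h, _⟩
      exact ⟨hw, h⟩
  · intro w hw
    exact (mk_mem_pairs.1 (Finset.mem_inter.1 hw).2).1.2

lemma card_neighbors (D : Finset (Sym2 U)) (A : Finset U) (u : U) :
    (A.filter fun w => s(u, w) ∈ D).card + (Aᶜ.filter fun w => s(u, w) ∈ D).card = deg D u := by
  rw [deg_eq_card_adj D Finset.univ u (fun _ _ => Finset.mem_univ _),
    ← Finset.card_union_of_disjoint
      (Finset.disjoint_filter_filter disjoint_compl_right), ← Finset.filter_union,
    Finset.union_compl]

lemma card_leaf_neighbors (hd : HubDegrees d A Δ) (hD : D ∈ extensions d A E) {u : U}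
    (hu : u ∈ A) : deg E u + (Aᶜ.filter fun w => s(u, w) ∈ D).card = Δ := by
  rw [← card_hub_neighbors hD hu, card_neighbors, (mem_extensions.1 hD).1.2, hd.hub u hu]

/-- Each leaf has one edge, and each edge inside `A` frees two leaves from hubs. The pairs are
ordered, so a leaf–leaf edge counts twice. -/
lemma card_leaf_pairs (hd : HubDegrees d A Δ) (hD : D ∈ extensions d A E) :
    ((Aᶜ ×ˢ Aᶜ).filter fun q => s(q.1, q.2) ∈ D).card + A.card * Δ = Aᶜ.card + 2 * E.card := by
  have hE : E ⊆ pairs A := by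
    rw [← (mem_extensions.1 hD).2]; exact Finset.inter_subset_right
  have hcard : ∀ S T : Finset U, ((S ×ˢ T).filter fun q => s(q.1, q.2) ∈ D).card =
      ∑ x ∈ S, (T.filter fun w => s(x, w) ∈ D).card := by
    intro S T
    simp_rw [Finset.card_filter]
    rw [Finset.sum_product]
  have h1 : ∑ x ∈ Aᶜ, ((A.filter fun w => s(x, w) ∈ D).card +
      (Aᶜ.filter fun w => s(x, w) ∈ D).card) = Aᶜ.card := by
    rw [Finset.card_eq_sum_ones]
    refine Finset.sum_congr rfl fun x hx => ?_
    rw [card_neighbors, (mem_extensions.1 hD).1.2, hd.leaf x (Finset.mem_compl.1 hx)]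
  have h2 : ∑ a ∈ A, (deg E a + (Aᶜ.filter fun w => s(a, w) ∈ D).card) = A.card * Δ := by
    rw [Finset.sum_const_nat]
    exact fun a ha => card_leaf_neighbors hd hD ha
  have h3 : ∑ a ∈ A, deg E a = 2 * E.card := by
    rw [← sum_deg hE]
    exact Finset.sum_subset (Finset.subset_univ _) fun v _ hv => deg_eq_zero hE hv
  have h4 : ∑ x ∈ Aᶜ, (A.filter fun w => s(x, w) ∈ D).card =
      ∑ a ∈ A, (Aᶜ.filter fun w => s(a, w) ∈ D).card := by
    simp_rw [Finset.card_filter]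
    rw [Finset.sum_comm]
    simp_rw [Sym2.eq_swap]
  rw [hcard]
  rw [Finset.sum_add_distrib] at h1 h2
  omega

/-- Replace the edges `e`, `e'` by `f`, `f'`. -/
def switch (D : Finset (Sym2 U)) (e e' f f' : Sym2 U) : Finset (Sym2 U) :=
  insert f (insert f' ((D.erase e).erase e'))

lemma deg_switch {e e' f f' : Sym2 U} (he : e ∈ D) (he' : e' ∈ D) (hee : e ≠ e')
    (hf : f ∉ D) (hf' : f' ∉ D) (hff : f ≠ f') {w : U}
    (hw : (if w ∈ e then 1 else 0) + (if w ∈ e' then 1 else 0) =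
      (if w ∈ f then 1 else 0) + (if w ∈ f' then 1 else 0)) :
    deg (switch D e e' f f') w = deg D w := by
  have h1 : D = insert e (insert e' ((D.erase e).erase e')) := by
    rw [Finset.insert_erase (by simp [he', hee.symm]), Finset.insert_erase he]
  have h2 : deg D w = deg ((D.erase e).erase e') w + (if w ∈ e' then 1 else 0) +
      (if w ∈ e then 1 else 0) := by
    conv_lhs => rw [h1]
    rw [deg_insert (by simp [hee]), deg_insert (by simp)]
  rw [switch, deg_insert (by simp [hf, hff]), deg_insert (by simp [hf']), h2]
  omega

lemma switch_switch {e e' f f' : Sym2 U} (he : e ∈ D) (he' : e' ∈ D)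
    (hf : f ∉ D) (hf' : f' ∉ D) : switch (switch D e e' f f') f f' e e' = D := by
  ext g
  simp only [switch, Finset.mem_insert, Finset.mem_erase]
  grind

lemma switch_inter_pairs {e e' f f' : Sym2 U} (he' : e' ∉ pairs A) (hf : f ∉ pairs A)
    (hf' : f' ∉ pairs A) : switch D e e' f f' ∩ pairs A = (D ∩ pairs A).erase e := by
  ext g
  simp only [switch, Finset.mem_insert, Finset.mem_erase, Finset.mem_inter]
  grind

lemma switch_inter_pairs' {e e' f f' : Sym2 U} (he : e ∉ pairs A) (he' : e' ∉ pairs A)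
    (hf : f ∈ pairs A) (hf' : f' ∉ pairs A) :
    switch D e e' f f' ∩ pairs A = insert f (D ∩ pairs A) := by
  ext g
  simp only [switch, Finset.mem_insert, Finset.mem_erase, Finset.mem_inter]
  grind

lemma switch_subset {e e' f f' : Sym2 U} {F : Finset (Sym2 U)} (hD : D ⊆ F) (hf : f ∈ F)
    (hf' : f' ∈ F) : switch D e e' f f' ⊆ F := by
  intro g
  simp only [switch, Finset.mem_insert, Finset.mem_erase]
  rintro (rfl | rfl | h)
  exacts [hf, hf', hD h.2.2]

/-- The switching `uv, xy ↔ ux, vy` with leaves `x`, `y`. -/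
lemma sum_leaf_pairs_eq (hd : HubDegrees d A Δ) {u v : U} (hu : u ∈ A) (hv : v ∈ A)
    (huv : u ≠ v) (he : s(u, v) ∉ E) :
    ∑ D ∈ extensions d A (insert s(u, v) E),
        ((Aᶜ ×ˢ Aᶜ).filter fun q => s(q.1, q.2) ∈ D).card =
      ∑ D ∈ extensions d A E,
        ((Aᶜ ×ˢ Aᶜ).filter fun q => s(u, q.1) ∈ D ∧ s(v, q.2) ∈ D).card := by
  rw [← Finset.card_sigma, ← Finset.card_sigma]
  -- Both pairs of edges cover each of `u`, `v`, `x`, `y` exactly once, so the switching preserves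
  -- degrees.
  have hcount : ∀ {x y : U}, x ∉ A → y ∉ A → x ≠ y → ∀ w : U,
      (if w ∈ s(u, v) then 1 else 0) + (if w ∈ s(x, y) then 1 else 0) =
      (if w ∈ s(u, x) then 1 else 0) + (if w ∈ s(v, y) then 1 else 0) := by
    intro x y hx hy hxy w
    simp only [Sym2.mem_iff]
    grind
  have hne : ∀ {x y : U}, x ∉ A → y ∉ A → x ≠ y →
      s(u, v) ≠ s(x, y) ∧ s(u, x) ≠ s(v, y) ∧ s(x, y) ≠ s(u, x) ∧ s(x, y) ≠ s(v, y) := by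
    intro x y hx hy hxy
    simp only [ne_eq, Sym2.eq_iff]
    grind
  have hpu : s(u, v) ∈ pairs A := mk_mem_pairs.2 ⟨⟨hu, hv⟩, huv⟩
  have hout : ∀ {a x : U}, x ∉ A → s(a, x) ∉ pairs A :=
    fun hx h => hx (mk_mem_pairs.1 h).1.2
  -- The switching never creates a multiple edge: `x` and `y` have degree 1 and already use their
  -- only edge.
  have hfwd : ∀ {D : Finset (Sym2 U)} {x y : U}, D ∈ extensions d A (insert s(u, v) E) →
      x ∉ A → y ∉ A → s(x, y) ∈ D →
      x ≠ y ∧ s(u, v) ∈ D ∧ s(u, x) ∉ D ∧ s(v, y) ∉ D := by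
    intro D x y hD hx hy hxy
    have hD := mem_extensions.1 hD
    have hxy' := ne_of_mem_pairs hD.1.1 hxy
    have := hne hx hy hxy'
    refine ⟨hxy', ?_, fun h => ?_, fun h => ?_⟩
    · have : s(u, v) ∈ D ∩ pairs A := by rw [hD.2]; simp
      exact (Finset.mem_inter.1 this).1
    · exact this.2.2.1 (eq_of_deg_eq_one ((hD.1.2 x).trans (hd.leaf x hx)) hxy h (by simp)
        (by simp))
    · exact this.2.2.2 (eq_of_deg_eq_one ((hD.1.2 y).trans (hd.leaf y hy)) hxy h (by simp)
        (by simp))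
  have hbwd : ∀ {D : Finset (Sym2 U)} {x y : U}, D ∈ extensions d A E →
      x ∉ A → y ∉ A → s(u, x) ∈ D → s(v, y) ∈ D →
      x ≠ y ∧ s(u, v) ∉ D ∧ s(x, y) ∉ D := by
    intro D x y hD hx hy hux hvy
    have hD := mem_extensions.1 hD
    have hxy : x ≠ y := by
      rintro rfl
      have := eq_of_deg_eq_one ((hD.1.2 x).trans (hd.leaf x hx)) hux hvy (by simp) (by simp)
      rcases Sym2.eq_iff.1 this with h | h
      · exact huv h.1
      · exact hx (h.1 ▸ hu)
    refine ⟨hxy, fun h => he ?_, fun h => ?_⟩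
    · rw [← hD.2]; exact Finset.mem_inter.2 ⟨h, hpu⟩
    · exact (hne hx hy hxy).2.2.1 (eq_of_deg_eq_one ((hD.1.2 x).trans (hd.leaf x hx)) h hux
        (by simp) (by simp))
  have hpair : ∀ {a b : U}, a ≠ b → s(a, b) ∈ pairs (Finset.univ : Finset U) :=
    fun h => mk_mem_pairs.2 ⟨by simp, h⟩
  have hA : ∀ {a b : U}, a ∈ A → b ∉ A → a ≠ b := fun ha hb h => hb (h ▸ ha)
  refine Finset.card_bij' (fun q _ => ⟨switch q.1 s(u, v) s(q.2.1, q.2.2) s(u, q.2.1)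
      s(v, q.2.2), q.2⟩) (fun q _ => ⟨switch q.1 s(u, q.2.1) s(v, q.2.2) s(u, v)
      s(q.2.1, q.2.2), q.2⟩) ?_ ?_ ?_ ?_
  all_goals
    rintro ⟨D, x, y⟩ h
    simp only [Finset.mem_sigma, Finset.mem_filter, Finset.mem_product, Finset.mem_compl] at h
  · obtain ⟨hD, ⟨hx, hy⟩, hxy⟩ := h
    obtain ⟨h1, h2, h3, h4⟩ := hfwd hD hx hy hxy
    have hn := hne hx hy h1
    have hD := mem_extensions.1 hD
    simp only [Finset.mem_sigma, Finset.mem_filter, Finset.mem_product, Finset.mem_compl,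
      mem_extensions]
    refine ⟨⟨⟨switch_subset hD.1.1 (hpair (hA hu hx)) (hpair (hA hv hy)), fun w => ?_⟩, ?_⟩,
      ⟨hx, hy⟩, ?_, ?_⟩
    · rw [deg_switch h2 hxy hn.1 h3 h4 hn.2.1 (hcount hx hy h1 w), hD.1.2]
    · rw [switch_inter_pairs (hout hy) (hout hx) (hout hy), hD.2, Finset.erase_insert he]
    · simp [switch]
    · simp [switch]
  · obtain ⟨hD, ⟨hx, hy⟩, hux, hvy⟩ := h
    obtain ⟨h1, h2, h3⟩ := hbwd hD hx hy hux hvy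
    have hn := hne hx hy h1
    have hD := mem_extensions.1 hD
    simp only [Finset.mem_sigma, Finset.mem_filter, Finset.mem_product, Finset.mem_compl,
      mem_extensions]
    refine ⟨⟨⟨switch_subset hD.1.1 (hpair huv) (hpair h1), fun w => ?_⟩, ?_⟩, ⟨hx, hy⟩, ?_⟩
    · rw [deg_switch hux hvy hn.2.1 h2 h3 hn.1 (hcount hx hy h1 w).symm, hD.1.2]
    · rw [switch_inter_pairs' (hout hx) (hout hy) hpu (hout hy), hD.2]
    · simp [switch]
  · obtain ⟨hD, ⟨hx, hy⟩, hxy⟩ := h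
    obtain ⟨h1, h2, h3, h4⟩ := hfwd hD hx hy hxy
    simp only [switch_switch h2 hxy h3 h4]
  · obtain ⟨hD, ⟨hx, hy⟩, hux, hvy⟩ := h
    obtain ⟨h1, h2, h3⟩ := hbwd hD hx hy hux hvy
    simp only [switch_switch hux hvy h2 h3]

/-- The number of realizations with a prescribed hub graph is proportional to its weight. -/
lemma card_extensions {p : ℕ} (hd : HubDegrees d A Δ) (hp : Aᶜ.card = 2 * p + A.card * Δ)
    (hE : E ⊆ pairs A) :
    ((extensions d A E).card : ℝ) = (extensions d A ∅).card * weight Δ p E := by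
  induction E using Finset.induction_on with
  | empty => simp
  | insert e E he ih =>
    have ih := ih ((Finset.subset_insert e E).trans hE)
    have heA := hE (Finset.mem_insert_self e E)
    induction e using Sym2.ind with | _ u v =>
    obtain ⟨⟨hu, hv⟩, huv⟩ := mk_mem_pairs.1 heA
    have hsum := sum_leaf_pairs_eq hd hu hv huv he
    -- On both sides of the double count the number of switchings is the same for every realization,
    -- so the ratio of the two counts is exact.
    rw [Finset.sum_const_nat (m := 2 * (p + E.card + 1)),
      Finset.sum_const_nat (m := (Δ - deg E u) * (Δ - deg E v))] at hsum
    · have hw := weight_insert Δ p huv he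
      have h2 : (0 : ℝ) < 2 * (p + E.card + 1) := by positivity
      have hsum' : ((extensions d A (insert s(u, v) E)).card : ℝ) * (2 * (p + E.card + 1)) =
          (extensions d A E).card * (((Δ - deg E u : ℕ) : ℝ) * ((Δ - deg E v : ℕ) : ℝ)) := by
        exact_mod_cast hsum
      refine mul_right_cancel₀ h2.ne' ?_
      rw [hsum', ih, mul_assoc _ (weight Δ p (insert s(u, v) E)), hw]
      ring
    · intro D hD
      rw [show (Aᶜ ×ˢ Aᶜ).filter (fun q => s(u, q.1) ∈ D ∧ s(v, q.2) ∈ D) =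
        (Aᶜ.filter fun w => s(u, w) ∈ D) ×ˢ (Aᶜ.filter fun w => s(v, w) ∈ D) by
          ext; simp; tauto, Finset.card_product]
      have h1 := card_leaf_neighbors hd hD hu
      have h2 := card_leaf_neighbors hd hD hv
      congr 1 <;> omega
    · intro D hD
      have h1 := card_leaf_pairs hd hD
      rw [Finset.card_insert_of_notMem he] at h1
      omega

/-- The number of realizations whose hub graph lies in a given family. -/
lemma card_filter_edgeRealizations {p : ℕ} (hd : HubDegrees d A Δ)
    (hp : Aᶜ.card = 2 * p + A.card * Δ) (P : Finset (Sym2 U) → Prop) [DecidablePred P] :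
    (((edgeRealizations d).filter fun D => P (D ∩ pairs A)).card : ℝ) =
      (extensions d A ∅).card * ∑ E ∈ (pairs A).powerset.filter P, weight Δ p E := by
  rw [Finset.card_eq_sum_card_fiberwise (f := fun D => D ∩ pairs A)
    (t := (pairs A).powerset.filter P), Nat.cast_sum, Finset.mul_sum]
  · refine Finset.sum_congr rfl fun E hE => ?_
    rw [Finset.mem_filter, Finset.mem_powerset] at hE
    rw [← card_extensions hd hp hE.1, Finset.filter_filter]
    congr 2
    ext D
    simp only [extensions, Finset.mem_filter]
    constructor
    · rintro ⟨h1, -, h2⟩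
      exact ⟨h1, h2⟩
    · rintro ⟨h1, h2⟩
      exact ⟨h1, h2 ▸ hE.2, h2⟩
  · intro D hD
    simp only [Finset.coe_filter, Set.mem_ofPred_eq, Finset.mem_powerset] at hD ⊢
    exact ⟨Finset.inter_subset_right, hD.2⟩

lemma card_edgeRealizations {p : ℕ} (hd : HubDegrees d A Δ)
    (hp : Aᶜ.card = 2 * p + A.card * Δ) :
    ((edgeRealizations d).card : ℝ) = (extensions d A ∅).card * partition Δ p A := by
  simpa [partition] using card_filter_edgeRealizations hd hp (fun _ => True)

end

end HubGraph

/-! ### From edge counts to the uniform model -/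

namespace HubGraph

variable {U : Type*} [DecidableEq U] [Fintype U]

/-- Lets `uniformOn` of a finite set be evaluated by counting. -/
instance : MeasurableSingletonClass (SimpleGraph U) where
  measurableSet_singleton G := by
    have h : ({G} : Set (SimpleGraph U)) =
        ⋂ u, ⋂ v, {G' : SimpleGraph U | G'.Adj u v ↔ G.Adj u v} := by
      ext G'
      simp only [Set.mem_singleton_iff, Set.mem_iInter, Set.mem_ofPred_eq]
      constructor
      · rintro rfl _ _; rfl
      · intro h; ext u v; exact h u v
    rw [h]
    refine MeasurableSet.iInter fun u => MeasurableSet.iInter fun v => ?_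
    have hm : Measurable fun G' : SimpleGraph U => G'.Adj u v :=
      SimpleGraph.measurable_iff_adj.1 measurable_id u v
    exact measurableSet_setOfPred.2 (hm.iff measurable_const)

open Classical in
lemma deg_edgeFinset (G : SimpleGraph U) (v : U) : deg G.edgeFinset v = G.degree v := by
  rw [← SimpleGraph.card_incidenceFinset_eq_degree, SimpleGraph.incidenceFinset_eq_filter, deg]

open Classical in
lemma edgeFinset_mem_edgeRealizations {d : U → ℕ} {G : SimpleGraph U} :
    G.edgeFinset ∈ edgeRealizations d ↔ G ∈ DegreeSequence.realizations d := by
  rw [mem_edgeRealizations]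
  simp only [deg_edgeFinset, DegreeSequence.realizations, Set.mem_ofPred_eq]
  constructor
  · rintro ⟨-, h⟩ v
    convert h v
  · intro h
    refine ⟨fun e he => ?_, fun v => by convert h v⟩
    rw [SimpleGraph.mem_edgeFinset] at he
    exact mem_pairs.2 ⟨by simp, G.not_isDiag_of_mem_edgeSet he⟩

lemma exists_edgeFinset_eq {d : U → ℕ} {D : Finset (Sym2 U)} (hD : D ∈ edgeRealizations d) :
    ∃ G ∈ DegreeSequence.realizations d, G.edgeSet = D := by
  classical
  obtain ⟨G, hG⟩ : ∃ G : SimpleGraph U, G.edgeSet = D := by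
    refine ⟨SimpleGraph.fromEdgeSet D, ?_⟩
    rw [SimpleGraph.edgeSet_fromEdgeSet]
    ext e
    simp only [Set.mem_sdiff, Finset.mem_coe]
    exact ⟨fun h => h.1, fun h => ⟨h, (mem_pairs.1 ((mem_edgeRealizations.1 hD).1 h)).2⟩⟩
  refine ⟨G, ?_, hG⟩
  rw [← edgeFinset_mem_edgeRealizations]
  convert hD
  ext e
  rw [SimpleGraph.mem_edgeFinset, hG, Finset.mem_coe]

lemma isGraphical_iff {d : U → ℕ} :
    DegreeSequence.IsGraphical d ↔ (edgeRealizations d).Nonempty := by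
  classical
  constructor
  · rintro ⟨G, hG⟩
    exact ⟨_, edgeFinset_mem_edgeRealizations.2 hG⟩
  · rintro ⟨D, hD⟩
    obtain ⟨G, hG, -⟩ := exists_edgeFinset_eq hD
    exact ⟨G, hG⟩

/-- A bound for the probability of an event in terms of a count of edge sets. -/
lemma uniformModel_compl_le {d : U → ℕ} (hd : DegreeSequence.IsGraphical d)
    (T : Set (SimpleGraph U)) (P : Finset (Sym2 U) → Prop) [DecidablePred P]
    (hT : ∀ G ∈ DegreeSequence.realizations d, ∀ D : Finset (Sym2 U), G.edgeSet = D →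
      ¬ P D → G ∈ T) {β : ℝ}
    (hβ : (((edgeRealizations d).filter P).card : ℝ) ≤ β * (edgeRealizations d).card) :
    ENNReal.ofReal (1 - β) ≤ DegreeSequence.uniformModel d T := by
  classical
  have hfin : (DegreeSequence.realizations d).Finite := Set.toFinite _
  have hprob : MeasureTheory.IsProbabilityMeasure (DegreeSequence.uniformModel d) :=
    ProbabilityTheory.isProbabilityMeasure_uniformOn hfin hd
  have hβ0 : 0 ≤ β := by
    have : 0 < ((edgeRealizations d).card : ℝ) := by
      exact_mod_cast Finset.card_pos.2 (isGraphical_iff.1 hd)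
    by_contra h
    have := mul_neg_of_neg_of_pos (not_le.1 h) this
    have h2 : (0 : ℝ) ≤ ((edgeRealizations d).filter P).card := by positivity
    linarith
  have hc : DegreeSequence.uniformModel d Tᶜ ≤ ENNReal.ofReal β := by
    have h1 : ((hfin.toFinset : Finset (SimpleGraph U)) : Set (SimpleGraph U)) =
      DegreeSequence.realizations d := hfin.coe_toFinset
    have h2 : (((Set.toFinite Tᶜ).toFinset : Finset (SimpleGraph U)) : Set (SimpleGraph U)) = Tᶜ :=
      Set.Finite.coe_toFinset _
    unfold DegreeSequence.uniformModel
    rw [← h1, ← h2, ProbabilityTheory.uniformOn_apply_finset]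
    have hinj : Function.Injective fun G : SimpleGraph U => G.edgeFinset := by
      intro G G' h
      exact SimpleGraph.edgeFinset_inj.1 h
    have hcard : hfin.toFinset.card = (edgeRealizations d).card := by
      rw [← Finset.card_image_of_injective _ hinj]
      congr 1
      ext D
      simp only [Finset.mem_image, Set.Finite.mem_toFinset]
      constructor
      · rintro ⟨G, hG, rfl⟩
        exact edgeFinset_mem_edgeRealizations.2 hG
      · intro hD
        obtain ⟨G, hG, h⟩ := exists_edgeFinset_eq hD
        refine ⟨G, hG, ?_⟩
        ext e
        rw [SimpleGraph.mem_edgeFinset, h, Finset.mem_coe]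
    have hcard2 : (hfin.toFinset ∩ (Set.toFinite Tᶜ).toFinset).card ≤
        ((edgeRealizations d).filter P).card := by
      rw [← Finset.card_image_of_injective _ hinj]
      refine Finset.card_le_card ?_
      intro D hD
      obtain ⟨G, hG, rfl⟩ := Finset.mem_image.1 hD
      simp only [Finset.mem_inter, Set.Finite.mem_toFinset, Set.mem_compl_iff] at hG
      refine Finset.mem_filter.2 ⟨edgeFinset_mem_edgeRealizations.2 hG.1, ?_⟩
      by_contra hP
      exact hG.2 (hT G hG.1 _ (by simp) hP)
    rw [hcard]
    have hpos : 0 < ((edgeRealizations d).card : ℝ) := by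
      exact_mod_cast Finset.card_pos.2 (isGraphical_iff.1 hd)
    refine ENNReal.div_le_of_le_mul ?_
    rw [← ENNReal.ofReal_natCast, ← ENNReal.ofReal_natCast, ← ENNReal.ofReal_mul hβ0]
    refine ENNReal.ofReal_le_ofReal (le_trans ?_ hβ)
    exact_mod_cast hcard2
  have hm : MeasurableSet T := (Set.toFinite T).measurableSet
  have := MeasureTheory.prob_compl_eq_one_sub (μ := DegreeSequence.uniformModel d) hm.compl
  rw [compl_compl] at this
  rw [this, ENNReal.ofReal_sub _ hβ0, ENNReal.ofReal_one]
  exact tsub_le_tsub_left hc 1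

/-- A component of the hub graph with `k` hubs has about `k Δ` leaves attached to it. -/
lemma le_largestComponentOrder {d : U → ℕ} {A : Finset U} {Δ k r : ℕ} (hd : HubDegrees d A Δ)
    {G : SimpleGraph U} {D : Finset (Sym2 U)} (hD : D ∈ edgeRealizations d)
    (hG : G.edgeSet = D) {v : U} (hv : v ∈ A) (hk : k ≤ (reach (D ∩ pairs A) v).card)
    (hr : ∀ u ∈ A, deg (D ∩ pairs A) u ≤ r) :
    k * (Δ - r) ≤ largestComponentOrder G := by
  classical
  set E := D ∩ pairs A with hE
  have hDE : D ∈ extensions d A E := by simp [extensions, hD, hE]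
  have hD' := mem_edgeRealizations.1 hD
  have hSA : reach E v ⊆ A := reach_subset_of_subset_pairs Finset.inter_subset_right hv
  have hadj : ∀ {a b : U}, s(a, b) ∈ D → G.Adj a b := by
    intro a b h
    rw [← SimpleGraph.mem_edgeSet, hG]
    exact h
  have hreach : ∀ u ∈ reach E v, G.Reachable v u := by
    intro u hu
    rw [mem_reach] at hu
    induction hu with
    | refl => rfl
    | tail _ h2 ih => exact ih.trans (hadj (Finset.mem_inter.1 h2).1).reachable
  -- The leaves attached to the component. Distinct hubs have disjoint sets of leaves, since a leaf
  -- has only one edge.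
  set L := (reach E v).biUnion fun u => Aᶜ.filter fun w => s(u, w) ∈ D with hL
  have hcard : k * (Δ - r) ≤ L.card := by
    rw [hL, Finset.card_biUnion]
    · calc k * (Δ - r) ≤ (reach E v).card * (Δ - r) := Nat.mul_le_mul_right _ hk
        _ ≤ _ := by
          rw [← smul_eq_mul]
          refine Finset.card_nsmul_le_sum _ _ _ fun u hu => ?_
          have := card_leaf_neighbors hd hDE (hSA hu)
          have := hr u (hSA hu)
          omega
    · intro u hu u' hu' hne
      rw [Function.onFun, Finset.disjoint_left]
      intro x hx hx'
      simp only [Finset.mem_filter, Finset.mem_compl] at hx hx'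
      have := eq_of_deg_eq_one ((hD'.2 x).trans (hd.leaf x hx.1)) hx.2 hx'.2 (by simp) (by simp)
      rcases Sym2.eq_iff.1 this with h | h
      · exact hne h.1
      · exact hx.1 (h.1 ▸ hSA hu)
  have hsub : (L : Set U) ⊆ (G.connectedComponentMk v).supp := by
    intro x hx
    rw [Finset.mem_coe, hL, Finset.mem_biUnion] at hx
    obtain ⟨u, hu, hx⟩ := hx
    rw [SimpleGraph.ConnectedComponent.mem_supp_iff, SimpleGraph.ConnectedComponent.eq]
    exact ((hreach u hu).trans (hadj (Finset.mem_filter.1 hx).2).reachable).symm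
  calc _ ≤ L.card := hcard
    _ = (L : Set U).ncard := (Set.ncard_coe_finset L).symm
    _ ≤ (G.connectedComponentMk v).supp.ncard := Set.ncard_le_ncard hsub (Set.toFinite _)
    _ ≤ _ := le_ciSup (f := fun c : G.ConnectedComponent => c.supp.ncard)
        (Set.finite_range _).bddAbove (G.connectedComponentMk v)

/-- A quantitative lower bound for the largest component in the uniform model. -/
theorem le_uniformModel_largestComponentOrder {d : U → ℕ} {A : Finset U} {Δ p b h a t r P M : ℕ}
    (hd : HubDegrees d A Δ) (hgr : DegreeSequence.IsGraphical d)
    (hp : Aᶜ.card = 2 * p + A.card * Δ) (hp0 : 0 < p) (hb : 1 ≤ b) (hh : 1 ≤ h)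
    (hM : A.card * Δ ≤ M) (hA : a + b * h + 1 + t * (b * h + 1) ≤ A.card)
    (hP : p + t * (b * h + 1) ^ 2 ≤ P) {q : ℝ} (hq1 : q ≤ 1)
    (hq : q ≤ (a.choose b : ℝ) ^ h * b ^ (b * h) / b ^ b *
      ((((Δ - b * h : ℕ) : ℝ) ^ 2 / (2 * (P + (b * h : ℕ)))) ^ (b * h) *
        (((p : ℝ) / (p + M)) ^ (b * h) / (1 + odds Δ p) ^ ((b * h + 1) * A.card)))) :
    ENNReal.ofReal (1 - ((1 - q) ^ t + A.card * (A.card * odds Δ p) ^ r)) ≤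
      DegreeSequence.uniformModel d
        {G | (b * h + 1) * (Δ - r) ≤ largestComponentOrder G} := by
  classical
  set k := b * h + 1 with hk
  have hsmall : smallPartition k Δ p A ≤ (1 - q) ^ t * partition Δ p A := by
    refine smallPartition_le_pow (a := a + b * h + 1) (p₀ := p) (P := P) (H := A) hq1 ?_ (by omega)
      t A le_rfl hA p le_rfl hP
    intro A' hA' hc p' hp' hpP' v hv
    refine le_trans (mul_le_mul_of_nonneg_right hq (partition_pos _ _ _).le) ?_
    exact le_largeWeight hv hA' hb hc hp0 hp' hpP' hM
  have hdegs : ∑ E ∈ (pairs A).powerset.filter (fun E => ∃ u ∈ A, r ≤ deg E u), weight Δ p E ≤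
      A.card * (A.card * odds Δ p) ^ r * partition Δ p A := by
    calc _ ≤ ∑ u ∈ A, ∑ E ∈ (pairs A).powerset.filter (fun E => r ≤ deg E u), weight Δ p E := by
          simp_rw [Finset.sum_filter]
          rw [Finset.sum_comm]
          refine Finset.sum_le_sum fun E _ => ?_
          have hnn : ∀ u ∈ A, 0 ≤ if r ≤ deg E u then weight Δ p E else 0 := fun u _ => by
            split_ifs; exacts [weight_nonneg _ _ _, le_rfl]
          split_ifs with hex
          · obtain ⟨u, hu, hur⟩ := hex
            refine le_trans ?_ (Finset.single_le_sum hnn hu)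
            rw [if_pos hur]
          · exact Finset.sum_nonneg hnn
      _ ≤ ∑ u ∈ A, (A.card * odds Δ p) ^ r * partition Δ p A :=
          Finset.sum_le_sum fun u _ => sum_weight_deg_ge_le Δ p r A u
      _ = _ := by rw [Finset.sum_const, nsmul_eq_mul, mul_assoc]
  have hbad : ∑ E ∈ (pairs A).powerset.filter (fun E => (∀ v, (reach E v).card < k) ∨
      ∃ u ∈ A, r ≤ deg E u), weight Δ p E ≤
      ((1 - q) ^ t + A.card * (A.card * odds Δ p) ^ r) * partition Δ p A := by
    rw [Finset.filter_or, add_mul]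
    refine le_trans ?_ (add_le_add hsmall hdegs)
    unfold smallPartition
    rw [← Finset.sum_union_inter]
    exact le_add_of_nonneg_right (Finset.sum_nonneg fun _ _ => weight_nonneg _ _ _)
  refine uniformModel_compl_le hgr _ (fun D => (∀ v, (reach (D ∩ pairs A) v).card < k) ∨
      ∃ u ∈ A, r ≤ deg (D ∩ pairs A) u) ?_ ?_
  · intro G hG D hGD hPD
    push Not at hPD
    obtain ⟨⟨v, hv⟩, hr⟩ := hPD
    have hD : D ∈ edgeRealizations d := by
      have := edgeFinset_mem_edgeRealizations.2 hG
      convert this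
      ext e
      rw [SimpleGraph.mem_edgeFinset, hGD, Finset.mem_coe]
    -- A vertex outside `A` is isolated in the hub graph, whereas `k` is at least 2.
    have hvA : v ∈ A := by
      by_contra hvA
      have hsub : reach (D ∩ pairs A) v ⊆ {v} := by
        refine reach_subset (by simp) fun x y hx _ hxy => ?_
        rw [Finset.mem_singleton] at hx
        subst hx
        exact absurd (mk_mem_pairs.1 (Finset.mem_inter.1 hxy).2).1.1 hvA
      have h1 := Finset.card_le_card hsub
      rw [Finset.card_singleton] at h1
      have : 1 ≤ b * h := Nat.mul_pos hb hh
      omega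
    exact le_largestComponentOrder hd hD hGD hvA hv fun u hu => (hr u hu).le
  · rw [card_filter_edgeRealizations hd hp (fun E => (∀ v, (reach E v).card < k) ∨
      ∃ u ∈ A, r ≤ deg E u), card_edgeRealizations hd hp]
    calc _ ≤ _ := mul_le_mul_of_nonneg_left hbad (Nat.cast_nonneg _)
      _ = _ := by ring

end HubGraph

/-! ### Analytic estimates -/

namespace HubGraph

/-- The decay rate of the component sizes beats the constant of the lower bound. -/
lemma sub_one_sub_log_lt {x : ℝ} (h0 : 0 < x) (h1 : x < 1) :
    x - 1 - Real.log x < (1 - x) ^ 2 / (2 * x) := by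
  -- With `y = -log x > 0` the claim is equivalent to `y < sinh y`.
  have h : -Real.log x < Real.sinh (-Real.log x) :=
    Real.self_lt_sinh_iff.2 (by linarith [Real.log_neg h0 h1])
  rw [Real.sinh_eq, neg_neg, Real.exp_log h0, Real.exp_neg, Real.exp_log h0] at h
  have : (1 - x) ^ 2 / (2 * x) = (x⁻¹ - x) / 2 + x - 1 := by
    field_simp
    ring
  linarith

/-- Stirling's sequence decreases from its value `exp 1 / √2` at 1. The resulting factor `√b` is
then weakened to `b`. -/
lemma factorial_le_exp_one_mul {b : ℕ} (hb : 1 ≤ b) :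
    (b.factorial : ℝ) ≤ Real.exp 1 * b * (b / Real.exp 1) ^ b := by
  obtain ⟨m, rfl⟩ := Nat.exists_eq_add_of_le' hb
  have h := Stirling.stirlingSeq'_antitone (Nat.zero_le m)
  simp only [Function.comp, Nat.succ_eq_add_one, zero_add, Stirling.stirlingSeq_one] at h
  rw [Stirling.stirlingSeq, div_le_iff₀ (by positivity)] at h
  refine h.trans ?_
  have h2 : √(2 * ((m + 1 : ℕ) : ℝ)) = √2 * √((m + 1 : ℕ) : ℝ) := Real.sqrt_mul (by norm_num) _
  have h3 : √((m + 1 : ℕ) : ℝ) ≤ ((m + 1 : ℕ) : ℝ) := by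
    rw [Real.sqrt_le_left (by positivity)]
    have : (1 : ℝ) ≤ ((m + 1 : ℕ) : ℝ) := by exact_mod_cast hb
    nlinarith
  have h4 : (0 : ℝ) < √2 := by positivity
  rw [h2, ← mul_assoc]
  calc _ = Real.exp 1 * √((m + 1 : ℕ) : ℝ) * (((m + 1 : ℕ) : ℝ) / Real.exp 1) ^ (m + 1) := by
        field_simp
    _ ≤ _ := by gcongr

/-- Since `b ^ b / b!` is at least `exp b` up to a polynomial factor, the strict inequality in `h`
wins for large `b`. -/
lemma exists_pow_lt {ρ y : ℝ} (hρ : 0 < ρ) (hy : 0 < y) (h : ρ < y * Real.exp 1) :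
    ∃ b : ℕ, 1 ≤ b ∧ ρ ^ b < (b : ℝ) ^ b / b.factorial * y ^ b := by
  set θ := ρ / (y * Real.exp 1) with hθ
  have hθ0 : 0 ≤ θ := by positivity
  have hθ1 : θ < 1 := by rw [hθ, div_lt_one (by positivity)]; exact h
  have ht := (tendsto_self_mul_const_pow_of_lt_one hθ0 hθ1).const_mul (Real.exp 1)
  rw [mul_zero] at ht
  obtain ⟨b, hb1, hb⟩ := ((ht.eventually_lt_const (show (0 : ℝ) < 1 by norm_num)).and
    (eventually_ge_atTop 1)).exists
  refine ⟨b, hb, ?_⟩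
  have hf := factorial_le_exp_one_mul hb
  have hbp : (0 : ℝ) < b := by exact_mod_cast hb
  have hfp : (0 : ℝ) < b.factorial := by exact_mod_cast b.factorial_pos
  rw [div_mul_eq_mul_div, lt_div_iff₀ hfp]
  have hρθ : ρ = θ * (y * Real.exp 1) := by rw [hθ]; field_simp
  calc ρ ^ b * b.factorial ≤ ρ ^ b * (Real.exp 1 * b * (b / Real.exp 1) ^ b) := by gcongr
    _ = (Real.exp 1 * (b * θ ^ b)) * ((b : ℝ) ^ b * y ^ b) := by
        rw [hρθ, mul_pow, mul_pow, div_pow (b : ℝ) (Real.exp 1)]; field_simp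
    _ < 1 * ((b : ℝ) ^ b * y ^ b) := by gcongr
    _ = _ := one_mul _

/-- A more convenient lower bound for the success probability of an exploration. -/
lemma success_bound {a b h ℓ : ℕ} {Y Z o : ℝ} (hY : 0 ≤ Y) (hZ : 0 ≤ Z) (ho : 0 ≤ o) :
    Real.exp (-(ℓ * o)) / (b : ℝ) ^ b * ((b : ℝ) ^ b / b.factorial *
        (((a + 1 - b : ℕ) : ℝ) * Y * Z * Real.exp (-(ℓ * o))) ^ b) ^ h ≤
      (a.choose b : ℝ) ^ h * b ^ (b * h) / b ^ b *
      (Y ^ (b * h) * (Z ^ (b * h) / (1 + o) ^ ((b * h + 1) * ℓ))) := by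
  have h1 : ((a + 1 - b : ℕ) : ℝ) ^ b / b.factorial ≤ a.choose b := by
    rw [div_le_iff₀ (by exact_mod_cast b.factorial_pos), mul_comm]
    have := Nat.pow_sub_le_descFactorial a b
    rw [Nat.descFactorial_eq_factorial_mul_choose] at this
    exact_mod_cast this
  have h2 : (1 + o) ^ ((b * h + 1) * ℓ) ≤ Real.exp (ℓ * o) ^ (b * h + 1) := by
    rw [mul_comm, pow_mul, Real.exp_nat_mul]
    gcongr
    rw [add_comm]
    exact Real.add_one_le_exp o
  have h3 : Real.exp (-(ℓ * o)) ^ (b * h + 1) ≤ 1 / (1 + o) ^ ((b * h + 1) * ℓ) := by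
    rw [Real.exp_neg, inv_pow, ← one_div]
    gcongr
  calc _ = (((a + 1 - b : ℕ) : ℝ) ^ b / b.factorial) ^ h * (b : ℝ) ^ (b * h) / b ^ b *
        (Y ^ (b * h) * (Z ^ (b * h) * Real.exp (-(ℓ * o)) ^ (b * h + 1))) := by
        simp only [mul_pow, div_pow, pow_succ, pow_mul]
        ring
    _ ≤ (a.choose b : ℝ) ^ h * b ^ (b * h) / b ^ b *
      (Y ^ (b * h) * (Z ^ (b * h) * (1 / (1 + o) ^ ((b * h + 1) * ℓ)))) := by
        gcongr
    _ = _ := by ring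

lemma tendsto_log_sq_div_rpow (c B : ℝ) {γ : ℝ} (hγ : 0 < γ) :
    Tendsto (fun x : ℝ => (c * Real.log x + B) ^ 2 / x ^ γ) atTop (𝓝 0) := by
  have h1 : (fun x : ℝ => c * Real.log x + B) =o[atTop] fun x => x ^ (γ / 2) := by
    refine IsLittleO.add ((isLittleO_log_rpow_atTop (by positivity)).const_mul_left c) ?_
    rw [isLittleO_const_left]
    right
    exact tendsto_norm_atTop_atTop.comp (tendsto_rpow_atTop (by positivity))
  have h2 := h1.tendsto_div_nhds_zero.pow 2
  simp only [ne_eq, OfNat.ofNat_ne_zero, not_false_eq_true, zero_pow] at h2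
  refine h2.congr' ?_
  filter_upwards [eventually_gt_atTop 0] with x hx
  rw [div_pow, ← Real.rpow_natCast (x ^ (γ / 2)), ← Real.rpow_mul hx.le]
  norm_num

end HubGraph

/-! ### Choice of the exploration parameters -/

namespace HubGraph

set_option maxHeartbeats 1600000 in
/-- The parameters of the exploration. There are `t` explorations, each of which looks for a
component with `b * h + 1` hubs, and each of them succeeds with probability at least `q`. -/
lemma exists_exploration_parameters {ℓ p Δ : ℕ → ℕ} {lam c : ℝ} (h0 : 0 < lam) (h1 : lam < 1)
    (hc : 0 < c) (hcI : c * (lam - 1 - Real.log lam) < 1)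
    (hℓ : Tendsto (fun n => (ℓ n : ℝ)) atTop atTop)
    (hΔ : Tendsto (fun n => (Δ n : ℝ)) atTop atTop)
    (hlam : Tendsto (fun n => (ℓ n : ℝ) * (Δ n : ℝ) ^ 2 / (2 * p n)) atTop (𝓝 lam))
    (hlog : Tendsto (fun n => Real.log (ℓ n) / Δ n) atTop (𝓝 0)) :
    ∃ (b : ℕ) (h t : ℕ → ℕ) (q : ℕ → ℝ), 1 ≤ b ∧
      Tendsto (fun n => (1 - q n) ^ t n) atTop (𝓝 0) ∧
      ∀ᶠ n in atTop, 0 < p n ∧ 1 ≤ h n ∧ q n ≤ 1 ∧ c * Real.log (ℓ n) ≤ b * h n ∧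
        ∃ a P : ℕ, a + b * h n + 1 + t n * (b * h n + 1) ≤ ℓ n ∧
          p n + t n * (b * h n + 1) ^ 2 ≤ P ∧
          q n ≤ (a.choose b : ℝ) ^ h n * b ^ (b * h n) / b ^ b *
            ((((Δ n - b * h n : ℕ) : ℝ) ^ 2 / (2 * (P + (b * h n : ℕ)))) ^ (b * h n) *
            (((p n : ℝ) / (p n + (ℓ n * Δ n : ℕ))) ^ (b * h n) /
              (1 + odds (Δ n) (p n)) ^ ((b * h n + 1) * ℓ n))) := by
  -- the constants
  set I := lam - 1 - Real.log lam with hI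
  -- The gap above `I` pays for the fixed layer size `b` and all lower-order losses; `c * I' < 1`
  -- makes the explorations likely to succeed.
  obtain ⟨I', hI1, hI2⟩ : ∃ I', I < I' ∧ I' < 1 / c :=
    exists_between (by rw [lt_div_iff₀ hc]; linarith)
  have hIpos : 0 < I := by
    have := Real.log_lt_sub_one_of_pos h0 h1.ne
    rw [hI]; linarith
  set ρ := Real.exp (-I') with hρ
  have hρ0 : 0 < ρ := Real.exp_pos _
  have hρ1 : ρ < 1 := by rw [hρ, Real.exp_lt_one_iff]; linarith
  have hcI' : c * I' < 1 := by rw [lt_div_iff₀ hc] at hI2; linarith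
  -- An exploration succeeds with probability at least of order `ℓ^(-c * I')`. With about `ℓ^(1 -
  -- γ)` explorations the expected number of successes is at least of order `ℓ^γ`.
  set γ := (1 - c * I') / 2 with hγ
  have hγ0 : 0 < γ := by rw [hγ]; linarith
  have hγ1 : γ < 1 := by
    have : 0 < c * I' := by apply mul_pos hc; linarith
    rw [hγ]; linarith
  obtain ⟨b, hb, hbρ⟩ := exists_pow_lt (ρ := ρ) (y := lam * Real.exp (-lam)) hρ0 (by positivity)
    (by
      have h2 : lam * Real.exp (-lam) * Real.exp 1 = Real.exp (Real.log lam + -lam + 1) := by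
        rw [Real.exp_add, Real.exp_add, Real.exp_log h0]
      rw [hρ, h2, Real.exp_lt_exp]
      rw [hI] at hI1
      linarith)
  have hb' : (1 : ℝ) ≤ b := by exact_mod_cast hb
  set L : ℕ → ℝ := fun n => Real.log (ℓ n) with hL
  have hL0 : ∀ n, 0 ≤ L n := fun n => Real.log_natCast_nonneg _
  -- The summand 1 ensures `1 ≤ h n`.
  set h : ℕ → ℕ := fun n => ⌈c * L n / b⌉₊ + 1 with hh
  set j : ℕ → ℕ := fun n => b * h n with hj
  have hj1 : ∀ n, c * L n ≤ j n := by
    intro n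
    have := Nat.le_ceil (c * L n / b)
    rw [div_le_iff₀ (by linarith)] at this
    simp only [hj, hh]
    push_cast
    nlinarith
  have hj2 : ∀ n, (j n : ℝ) ≤ c * L n + 2 * b := by
    intro n
    have h2 : 0 ≤ c * L n / b := div_nonneg (mul_nonneg hc.le (hL0 n)) (by linarith)
    have := (Nat.ceil_lt_add_one h2).le
    have h3 : (b : ℝ) * (c * L n / b) = c * L n := by field_simp
    simp only [hj, hh]
    push_cast
    nlinarith
  set t : ℕ → ℕ := fun n => ⌊(ℓ n : ℝ) ^ (1 - γ)⌋₊ with ht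
  have ht1 : ∀ n, (t n : ℝ) ≤ (ℓ n : ℝ) ^ (1 - γ) := fun n => Nat.floor_le (by positivity)
  -- limits
  have hu : Tendsto (fun n => ((j n : ℝ) + 1) ^ 2 / (ℓ n : ℝ) ^ γ) atTop (𝓝 0) := by
    refine squeeze_zero (fun n => by positivity) (fun n => ?_)
      ((tendsto_log_sq_div_rpow c (2 * b + 1) hγ0).comp hℓ)
    have hle : (j n : ℝ) + 1 ≤ c * Real.log (ℓ n) + (2 * b + 1) := by
      have := hj2 n
      simp only [hL] at this
      linarith
    exact div_le_div_of_nonneg_right (pow_le_pow_left₀ (by positivity) hle 2) (by positivity)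
  have hℓ1 : ∀ᶠ n in atTop, (1 : ℝ) ≤ ℓ n := hℓ.eventually_ge_atTop 1
  -- Bounds both the fraction of hubs used up by all explorations and, as `ℓ n ≤ p n`, the relative
  -- growth of `p`.
  set w : ℕ → ℝ := fun n => (t n * ((j n : ℝ) + 1) ^ 2 + ((j n : ℝ) + 1) ^ 2) / ℓ n with hw
  have hw0 : Tendsto w atTop (𝓝 0) := by
    have h2 := hu.const_mul 2
    rw [mul_zero] at h2
    refine squeeze_zero' (Eventually.of_forall fun n => by positivity) ?_ h2
    filter_upwards [hℓ1] with n hn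
    have hx : (0 : ℝ) < ℓ n := by linarith
    have h3 : (ℓ n : ℝ) ^ (1 - γ) * (ℓ n : ℝ) ^ γ = ℓ n := by
      rw [← Real.rpow_add hx]; simp
    have h4 : (1 : ℝ) ≤ (ℓ n : ℝ) ^ (1 - γ) := Real.one_le_rpow hn (by linarith)
    have h5 : (0 : ℝ) < (ℓ n : ℝ) ^ γ := by positivity
    rw [hw, mul_div_assoc', div_le_div_iff₀ hx h5]
    have h6 : (t n * ((j n : ℝ) + 1) ^ 2 + ((j n : ℝ) + 1) ^ 2) ≤
        2 * ((j n : ℝ) + 1) ^ 2 * (ℓ n : ℝ) ^ (1 - γ) := by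
      have := ht1 n
      nlinarith [sq_nonneg ((j n : ℝ) + 1)]
    calc _ ≤ (2 * ((j n : ℝ) + 1) ^ 2 * (ℓ n : ℝ) ^ (1 - γ)) * (ℓ n : ℝ) ^ γ := by gcongr
      _ = _ := by rw [mul_assoc, h3]
  have hjΔ : Tendsto (fun n => (j n : ℝ) / Δ n) atTop (𝓝 0) := by
    have h2 := (hlog.const_mul c).add (hΔ.const_div_atTop (2 * b : ℝ))
    rw [mul_zero, add_zero] at h2
    refine squeeze_zero (fun n => by positivity) (fun n => ?_) h2
    rw [← mul_div_assoc, ← add_div]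
    have := hj2 n
    gcongr
  have hΔ1 : ∀ᶠ n in atTop, (1 : ℝ) ≤ Δ n := hΔ.eventually_ge_atTop 1
  have hp1 : ∀ᶠ n in atTop, 0 < p n := by
    filter_upwards [hlam.eventually (lt_mem_nhds h0)] with n hn
    by_contra hp
    simp only [not_lt, Nat.le_zero] at hp
    simp [hp] at hn
  have hM : Tendsto (fun n => (ℓ n : ℝ) * Δ n / p n) atTop (𝓝 0) := by
    have h2 := (hlam.const_mul 2).div_atTop hΔ
    refine h2.congr' ?_
    filter_upwards [hΔ1] with n hn
    have : (Δ n : ℝ) ≠ 0 := by linarith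
    field_simp
  have hℓp : ∀ᶠ n in atTop, (ℓ n : ℝ) ≤ p n := by
    filter_upwards [hM.eventually_lt_const (show (0 : ℝ) < 1 by norm_num), hp1, hΔ1] with n h2 h3 h4
    have h3' : (0 : ℝ) < p n := by exact_mod_cast h3
    rw [div_lt_one h3'] at h2
    have : (0 : ℝ) ≤ ℓ n := Nat.cast_nonneg _
    nlinarith
  have hptop : Tendsto (fun n => (p n : ℝ)) atTop atTop := tendsto_atTop_mono' _ hℓp hℓ
  set x : ℕ → ℝ := fun n => ℓ n * odds (Δ n) (p n) with hx
  have hxl : Tendsto x atTop (𝓝 lam) := by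
    have h2 : Tendsto (fun n => 1 / (1 + 1 / (p n : ℝ))) atTop (𝓝 1) := by
      have := (hptop.const_div_atTop (1 : ℝ)).const_add 1
      simpa using this.inv₀ (by norm_num)
    have h3 := hlam.mul h2
    rw [mul_one] at h3
    refine h3.congr' ?_
    filter_upwards [hp1] with n hn
    have : (0 : ℝ) < p n := by exact_mod_cast hn
    simp only [hx, odds]
    field_simp
  set P : ℕ → ℕ := fun n => p n + t n * (j n + 1) ^ 2 with hP
  have hpP : Tendsto (fun n => 1 / (1 + w n)) atTop (𝓝 1) := by
    have := hw0.const_add 1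
    simpa using this.inv₀ (by norm_num)
  have hZ : Tendsto (fun n => (p n : ℝ) / (p n + (ℓ n * Δ n : ℕ))) atTop (𝓝 1) := by
    have := (hM.const_add 1).inv₀ (by norm_num)
    rw [add_zero, inv_one] at this
    refine this.congr' ?_
    filter_upwards [hp1] with n hn
    have : (0 : ℝ) < p n := by exact_mod_cast hn
    push_cast
    field_simp
  -- A lower bound for the base of the power in `success_bound`: `lam * exp(-lam)` in the limit,
  -- with every loss as a separate factor.
  set Φ : ℕ → ℝ := fun n => (1 - w n - b / ℓ n) * ((ℓ n : ℝ) * (Δ n : ℝ) ^ 2 / (2 * p n)) *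
    (1 - (j n : ℝ) / Δ n) ^ 2 * (1 / (1 + w n)) * ((p n : ℝ) / (p n + (ℓ n * Δ n : ℕ))) *
    Real.exp (-x n) with hΦ
  have hΦl : Tendsto Φ atTop (𝓝 (lam * Real.exp (-lam))) := by
    have h2 := ((((((hw0.const_sub 1).sub (hℓ.const_div_atTop (b : ℝ))).mul hlam).mul
      ((hjΔ.const_sub 1).pow 2)).mul hpP).mul hZ).mul
        ((Real.continuous_exp.tendsto _).comp hxl.neg)
    simpa [hΦ] using h2
  have hΦρ : ∀ᶠ n in atTop, ρ ^ b < (b : ℝ) ^ b / b.factorial * Φ n ^ b :=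
    ((hΦl.pow b).const_mul _).eventually_const_lt hbρ
  have hΦ0 : ∀ᶠ n in atTop, 0 < Φ n := hΦl.eventually_const_lt (by positivity)
  -- Covers the prefactor in `success_bound`, because `ℓ * odds < 1` eventually.
  set C : ℝ := Real.exp (-1) / (b : ℝ) ^ b with hC
  have hC0 : 0 < C := by positivity
  have hC1 : C ≤ 1 := by
    rw [hC, div_le_one (by positivity)]
    exact (Real.exp_le_one_iff.2 (by norm_num)).trans (one_le_pow₀ hb')
  refine ⟨b, h, t, fun n => C * ρ ^ (j n), hb, ?_, ?_⟩
  · have hq1 : ∀ n, C * ρ ^ (j n) ≤ 1 := fun n =>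
      mul_le_one₀ hC1 (by positivity) (pow_le_one₀ hρ0.le hρ1.le)
    have hqt : Tendsto (fun n => C * ρ ^ (j n) * t n) atTop atTop := by
      have h2 : Tendsto (fun n => C * ρ ^ (2 * b) * ((ℓ n : ℝ) ^ γ - 1)) atTop atTop := by
        refine Tendsto.const_mul_atTop (by positivity) ?_
        exact tendsto_atTop_add_const_right _ _ ((tendsto_rpow_atTop hγ0).comp hℓ)
      refine tendsto_atTop_mono' _ ?_ h2
      filter_upwards [hℓ1] with n hn
      have hx0 : (0 : ℝ) < ℓ n := by linarith
      have h3 : ρ ^ (2 * b) * (ℓ n : ℝ) ^ (-(c * I')) ≤ ρ ^ (j n) := by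
        have e1 : ρ ^ (2 * b) = Real.exp (-I' * (2 * b)) := by
          rw [hρ, ← Real.exp_nat_mul]; push_cast; ring_nf
        have e2 : ρ ^ (j n) = Real.exp (-I' * j n) := by
          rw [hρ, ← Real.exp_nat_mul]; ring_nf
        rw [e1, e2, Real.rpow_def_of_pos hx0, ← Real.exp_add, Real.exp_le_exp]
        have := hj2 n
        have hI'0 : 0 < I' := hIpos.trans hI1
        simp only [hL] at this
        have := mul_le_mul_of_nonneg_left this hI'0.le
        linarith
      have h4 : (ℓ n : ℝ) ^ (1 - γ) - 1 ≤ t n := (Nat.sub_one_lt_floor _).le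
      have h5 : (ℓ n : ℝ) ^ (-(c * I')) * (ℓ n : ℝ) ^ (1 - γ) = (ℓ n : ℝ) ^ γ := by
        rw [← Real.rpow_add hx0]; congr 1; rw [hγ]; ring
      have h6 : (ℓ n : ℝ) ^ (-(c * I')) ≤ 1 := by
        apply Real.rpow_le_one_of_one_le_of_nonpos hn
        have : 0 < c * I' := mul_pos hc (hIpos.trans hI1)
        linarith
      calc C * ρ ^ (2 * b) * ((ℓ n : ℝ) ^ γ - 1) ≤
          C * ρ ^ (2 * b) * ((ℓ n : ℝ) ^ (-(c * I')) * ((ℓ n : ℝ) ^ (1 - γ) - 1)) := by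
            gcongr
            rw [mul_sub, h5]
            linarith
        _ = C * (ρ ^ (2 * b) * (ℓ n : ℝ) ^ (-(c * I'))) * ((ℓ n : ℝ) ^ (1 - γ) - 1) := by ring
        _ ≤ C * ρ ^ (j n) * t n := by
            have : 0 ≤ (ℓ n : ℝ) ^ (1 - γ) - 1 := by
              have := Real.one_le_rpow hn (show 0 ≤ 1 - γ by linarith)
              linarith
            gcongr
    refine squeeze_zero (fun n => pow_nonneg (by linarith [hq1 n]) _) (fun n => ?_)
      (Real.tendsto_exp_neg_atTop_nhds_zero.comp hqt)
    simp only [Function.comp]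
    calc (1 - C * ρ ^ (j n)) ^ t n ≤ Real.exp (-(C * ρ ^ (j n))) ^ t n := by
          refine pow_le_pow_left₀ (by linarith [hq1 n]) ?_ _
          linarith [Real.add_one_le_exp (-(C * ρ ^ (j n)))]
      _ = _ := by rw [← Real.exp_nat_mul]; ring_nf
  · filter_upwards [hp1, hℓ1, hΔ1, hℓp, hΦρ, hΦ0,
      hw0.eventually_lt_const (show (0 : ℝ) < 1 by norm_num),
      hjΔ.eventually_lt_const (show (0 : ℝ) < 1 by norm_num),
      hxl.eventually_lt_const h1] with n hp hℓn hΔn hℓpn hΦn hΦ0n hwn hjn hxn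
    have hpr : (0 : ℝ) < p n := by exact_mod_cast hp
    have hx0 : (0 : ℝ) < ℓ n := by linarith
    have hΔ0 : (0 : ℝ) < Δ n := by linarith
    have ho := odds_nonneg (Δ n) (p n)
    have hwn' : (t n : ℝ) * ((j n : ℝ) + 1) ^ 2 + ((j n : ℝ) + 1) ^ 2 = w n * ℓ n := by
      simp only [hw]; field_simp
    have hw0n : 0 ≤ w n := by positivity
    have hjn' : (j n : ℝ) < Δ n := by rwa [div_lt_one hΔ0] at hjn
    have huu : ((j n : ℝ) + 1) ≤ ((j n : ℝ) + 1) ^ 2 :=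
      le_self_pow₀ (by linarith [(Nat.cast_nonneg (j n) : (0 : ℝ) ≤ j n)]) two_ne_zero
    have hsmall : ((j n + 1 + t n * (j n + 1) : ℕ) : ℝ) ≤ w n * ℓ n := by
      rw [← hwn']
      push_cast
      have := mul_le_mul_of_nonneg_left huu (Nat.cast_nonneg (t n) : (0 : ℝ) ≤ t n)
      linarith
    have hle : j n + 1 + t n * (j n + 1) ≤ ℓ n := by
      have : ((j n + 1 + t n * (j n + 1) : ℕ) : ℝ) ≤ ℓ n :=
        hsmall.trans (mul_le_of_le_one_left hx0.le hwn.le)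
      exact_mod_cast this
    refine ⟨hp, by simp [hh], mul_le_one₀ hC1 (by positivity) (pow_le_one₀ hρ0.le hρ1.le),
      ?_, ℓ n - (j n + 1 + t n * (j n + 1)), P n, ?_, le_rfl, ?_⟩
    · have := hj1 n
      simp only [hj] at this
      exact_mod_cast this
    · change ℓ n - (j n + 1 + t n * (j n + 1)) + j n + 1 + t n * (j n + 1) ≤ ℓ n
      omega
    set a := ℓ n - (j n + 1 + t n * (j n + 1)) with ha
    refine le_trans ?_ (success_bound (by positivity) (by positivity) ho)
    have hkey : Φ n ≤ ((a + 1 - b : ℕ) : ℝ) *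
        (((Δ n - b * h n : ℕ) : ℝ) ^ 2 / (2 * (P n + (b * h n : ℕ)))) *
        ((p n : ℝ) / (p n + (ℓ n * Δ n : ℕ))) * Real.exp (-(ℓ n * odds (Δ n) (p n))) := by
      have hA : (1 - w n - b / ℓ n) * ℓ n ≤ ((a + 1 - b : ℕ) : ℝ) := by
        have h2 : ((ℓ n : ℕ) : ℝ) ≤ ((a + 1 - b : ℕ) : ℝ) + b +
            ((j n + 1 + t n * (j n + 1) : ℕ) : ℝ) := by
          exact_mod_cast (by omega : ℓ n ≤ (a + 1 - b) + b + (j n + 1 + t n * (j n + 1)))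
        have h3 : (1 - w n - b / ℓ n) * ℓ n = ℓ n - w n * ℓ n - b := by field_simp
        linarith
      have hcast : ((Δ n - b * h n : ℕ) : ℝ) = Δ n - j n := by
        rw [Nat.cast_sub]
        · exact_mod_cast hjn'.le
      have hPj : (P n : ℝ) + (b * h n : ℕ) ≤ p n * (1 + w n) := by
        have : (P n : ℝ) + (b * h n : ℕ) = p n + t n * ((j n : ℝ) + 1) ^ 2 + j n := by
          simp only [hP, hj]; push_cast; ring
        rw [this]
        have := mul_le_mul_of_nonneg_left hℓpn hw0n
        linarith
      have hB : ((ℓ n : ℝ) * (Δ n : ℝ) ^ 2 / (2 * p n)) * (1 - (j n : ℝ) / Δ n) ^ 2 *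
          (1 / (1 + w n)) ≤
          ℓ n * (((Δ n - b * h n : ℕ) : ℝ) ^ 2 / (2 * (P n + (b * h n : ℕ)))) := by
        have : ((ℓ n : ℝ) * (Δ n : ℝ) ^ 2 / (2 * p n)) * (1 - (j n : ℝ) / Δ n) ^ 2 *
          (1 / (1 + w n)) = ℓ n * (((Δ n : ℝ) - j n) ^ 2 / (2 * (p n * (1 + w n)))) := by
          field_simp
        rw [this, hcast]
        have hp2 : (0 : ℝ) < P n + (b * h n : ℕ) := by
          have : (p n : ℝ) ≤ P n := by exact_mod_cast Nat.le_add_right _ _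
          positivity
        gcongr
      -- All other factors of `Φ n` are nonnegative, and `Φ n` is positive.
      have hpos1 : 0 ≤ 1 - w n - b / ℓ n := by
        by_contra hneg
        have hneg := not_le.1 hneg
        have : Φ n ≤ 0 := by
          simp only [hΦ]
          rw [mul_assoc, mul_assoc, mul_assoc, mul_assoc]
          exact mul_nonpos_of_nonpos_of_nonneg hneg.le (by positivity)
        linarith
      calc Φ n = (1 - w n - b / ℓ n) * (((ℓ n : ℝ) * (Δ n : ℝ) ^ 2 / (2 * p n)) *
            (1 - (j n : ℝ) / Δ n) ^ 2 * (1 / (1 + w n))) *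
            ((p n : ℝ) / (p n + (ℓ n * Δ n : ℕ))) * Real.exp (-x n) := by
            simp only [hΦ]; ring
        _ ≤ (1 - w n - b / ℓ n) * (ℓ n * (((Δ n - b * h n : ℕ) : ℝ) ^ 2 /
              (2 * (P n + (b * h n : ℕ))))) *
            ((p n : ℝ) / (p n + (ℓ n * Δ n : ℕ))) * Real.exp (-x n) := by gcongr
        _ = ((1 - w n - b / ℓ n) * ℓ n) * (((Δ n - b * h n : ℕ) : ℝ) ^ 2 /
              (2 * (P n + (b * h n : ℕ)))) *
            ((p n : ℝ) / (p n + (ℓ n * Δ n : ℕ))) * Real.exp (-x n) := by ring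
        _ ≤ _ := by gcongr
    calc C * ρ ^ (j n) = C * (ρ ^ b) ^ h n := by simp only [hj]; rw [pow_mul]
      _ ≤ C * ((b : ℝ) ^ b / b.factorial * Φ n ^ b) ^ h n := by gcongr
      _ ≤ _ := by
        simp only [hC]
        gcongr

end HubGraph

/-! ### Existence of realizations, formulas for Q and R, and the limit theorem -/

namespace HubGraph

section
variable {U : Type*} [DecidableEq U] [Fintype U] {d : U → ℕ} {A : Finset U} {Δ : ℕ}

/-- Join every hub to `Δ` leaves of its own and match the remaining leaves. -/
lemma isGraphical_of_card {p : ℕ} (hd : HubDegrees d A Δ)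
    (hp : Aᶜ.card = 2 * p + A.card * Δ) : DegreeSequence.IsGraphical d := by
  have hcard : Fintype.card (Aᶜ : Finset U) =
      Fintype.card ((A × Fin Δ) ⊕ (Fin p × Bool)) := by
    simp only [Fintype.card_coe, Fintype.card_sum, Fintype.card_prod, Fintype.card_fin,
      Fintype.card_bool]
    omega
  let e := Fintype.equivOfCardEq hcard
  -- The other end of the only edge at a leaf: the hub that owns the leaf, or the leaf it is matched
  -- with.
  let g : (Aᶜ : Finset U) → U := fun x =>
    Sum.elim (fun q => (q.1 : U)) (fun q => ((e.symm (Sum.inr (q.1, !q.2)) : (Aᶜ : Finset U)) : U))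
      (e x)
  have hg1 : ∀ (a : A) (i : Fin Δ), g (e.symm (Sum.inl (a, i))) = a := by
    intro a i; simp [g]
  have hg2 : ∀ (k : Fin p) (s : Bool), g (e.symm (Sum.inr (k, s))) =
      (e.symm (Sum.inr (k, !s)) : (Aᶜ : Finset U)) := by
    intro k s; simp [g]
  let D : Finset (Sym2 U) := Finset.univ.image fun x : (Aᶜ : Finset U) => s((x : U), g x)
  have hcases : ∀ x : (Aᶜ : Finset U), (∃ a i, x = e.symm (Sum.inl (a, i))) ∨
      ∃ k s, x = e.symm (Sum.inr (k, s)) := by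
    intro x
    rcases h : e x with ⟨a, i⟩ | ⟨k, s⟩
    · exact Or.inl ⟨a, i, by rw [← h]; simp⟩
    · exact Or.inr ⟨k, s, by rw [← h]; simp⟩
  have hout : ∀ x : (Aᶜ : Finset U), (x : U) ∉ A := fun x => Finset.mem_compl.1 x.2
  have hmem : ∀ u w, s(u, w) ∈ D ↔ (∃ x : (Aᶜ : Finset U), (x : U) = u ∧ g x = w) ∨
      ∃ x : (Aᶜ : Finset U), (x : U) = w ∧ g x = u := by
    intro u w
    simp only [D, Finset.mem_image, Finset.mem_univ, true_and, Sym2.eq_iff]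
    grind
  refine isGraphical_iff.2 ⟨D, mem_edgeRealizations.2 ⟨?_, fun v => ?_⟩⟩
  · intro f hf
    obtain ⟨x, -, rfl⟩ := Finset.mem_image.1 hf
    refine mk_mem_pairs.2 ⟨by simp, ?_⟩
    rcases hcases x with ⟨a, i, rfl⟩ | ⟨k, s, rfl⟩
    · rw [hg1]
      intro h
      exact hout _ (h ▸ a.2)
    · rw [hg2]
      intro h
      have := e.symm.injective (Subtype.ext h)
      simp at this
  · rw [deg_eq_card_adj D Finset.univ v (fun _ _ => Finset.mem_univ _)]
    by_cases hv : v ∈ A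
    · rw [hd.hub v hv]
      have : (Finset.univ.filter fun w => s(v, w) ∈ D) =
          Finset.univ.image fun i : Fin Δ => ((e.symm (Sum.inl (⟨v, hv⟩, i)) : _) : U) := by
        ext w
        simp only [Finset.mem_filter, Finset.mem_univ, true_and, hmem, Finset.mem_image]
        constructor
        · rintro (⟨x, hx, -⟩ | ⟨x, rfl, hx⟩)
          · exact absurd hv (hx ▸ hout x)
          · rcases hcases x with ⟨a, i, rfl⟩ | ⟨k, s, rfl⟩
            · rw [hg1] at hx
              exact ⟨i, by congr 4; exact Subtype.ext hx.symm⟩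
            · rw [hg2] at hx
              exact absurd hv (hx ▸ hout _)
        · rintro ⟨i, rfl⟩
          exact Or.inr ⟨_, rfl, hg1 _ _⟩
      rw [this, Finset.card_image_of_injective, Finset.card_univ, Fintype.card_fin]
      intro i i' h
      have := e.symm.injective (Subtype.ext h)
      simpa using this
    · rw [hd.leaf v hv]
      have : (Finset.univ.filter fun w => s(v, w) ∈ D) =
          {g ⟨v, Finset.mem_compl.2 hv⟩} := by
        ext w
        simp only [Finset.mem_filter, Finset.mem_univ, true_and, hmem, Finset.mem_singleton]
        constructor
        · rintro (⟨x, rfl, hx⟩ | ⟨x, rfl, hx⟩)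
          · exact hx.symm
          · rcases hcases x with ⟨a, i, rfl⟩ | ⟨k, s, rfl⟩
            · rw [hg1] at hx
              exact absurd a.2 (hx ▸ hv)
            · rw [hg2] at hx
              subst hx
              rw [Subtype.coe_eta, hg2, Bool.not_not]
        · rintro rfl
          exact Or.inl ⟨_, rfl, rfl⟩
      rw [this, Finset.card_singleton]

lemma sum_of_hubDegrees (hd : HubDegrees d A Δ) (f : ℕ → ℝ) :
    ∑ v, f (d v) = A.card * f Δ + Aᶜ.card * f 1 := by
  rw [← Finset.sum_add_sum_compl A]
  congr 1
  · rw [Finset.sum_congr rfl fun v hv => by rw [hd.hub v hv], Finset.sum_const, nsmul_eq_mul]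
  · rw [Finset.sum_congr rfl fun v hv => by rw [hd.leaf v (Finset.mem_compl.1 hv)],
      Finset.sum_const, nsmul_eq_mul]

lemma degreeSum_of_hubDegrees (hd : HubDegrees d A Δ) :
    (DegreeSequence.degreeSum d : ℝ) = A.card * Δ + Aᶜ.card := by
  simpa [DegreeSequence.degreeSum] using sum_of_hubDegrees hd fun k => (k : ℝ)

lemma Q_of_hubDegrees (hd : HubDegrees d A Δ) :
    DegreeSequence.Q d = (A.card * (Δ * ((Δ : ℝ) - 2)) - Aᶜ.card) / (A.card * Δ + Aᶜ.card) := by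
  rw [DegreeSequence.Q, degreeSum_of_hubDegrees hd,
    sum_of_hubDegrees hd fun k => (k : ℝ) * ((k : ℝ) - 2)]
  push_cast
  ring

lemma R_of_hubDegrees (hd : HubDegrees d A Δ) :
    DegreeSequence.R d = (A.card * (Δ * ((Δ : ℝ) - 2) ^ 2) + Aᶜ.card) /
      (A.card * Δ + Aᶜ.card) := by
  rw [DegreeSequence.R, degreeSum_of_hubDegrees hd,
    sum_of_hubDegrees hd fun k => (k : ℝ) * ((k : ℝ) - 2) ^ 2]
  push_cast
  ring

end

/-- With high probability the largest component has order at least `c Δ log ℓ`, for every constant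
`c` below the reciprocal of the decay rate. -/
theorem tendsto_uniformModel_largestComponentOrder {N ℓ p Δ : ℕ → ℕ} {lam c : ℝ}
    (h0 : 0 < lam) (h1 : lam < 1) (hc : 0 < c) (hcI : c * (lam - 1 - Real.log lam) < 1)
    (hℓ : Tendsto (fun n => (ℓ n : ℝ)) atTop atTop)
    (hΔ : Tendsto (fun n => (Δ n : ℝ)) atTop atTop)
    (hlam : Tendsto (fun n => (ℓ n : ℝ) * (Δ n : ℝ) ^ 2 / (2 * p n)) atTop (𝓝 lam))
    (hlog : Tendsto (fun n => Real.log (ℓ n) / Δ n) atTop (𝓝 0))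
    {d : ∀ n, Fin (N n) → ℕ} {A : ∀ n, Finset (Fin (N n))}
    (hd : ∀ᶠ n in atTop, HubDegrees (d n) (A n) (Δ n) ∧ (A n).card = ℓ n ∧
      (A n)ᶜ.card = 2 * p n + (A n).card * Δ n)
    {s : ℕ → ℝ} (hs : ∀ᶠ n in atTop, s n ≤ c * Δ n * Real.log (ℓ n)) :
    Tendsto (fun n => DegreeSequence.uniformModel (d n)
      {G | s n ≤ (largestComponentOrder G : ℝ)}) atTop (𝓝 1) := by
  have hI : 0 < lam - 1 - Real.log lam := by
    have := Real.log_lt_sub_one_of_pos h0 h1.ne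
    linarith
  -- The hubs are counted with `c'` instead of `c`, so that a proportion `η = 1 - c / c'` of the
  -- leaves at every hub may be lost to edges between hubs.
  obtain ⟨c', hcc', hc'⟩ : ∃ c', c < c' ∧ c' < 1 / (lam - 1 - Real.log lam) :=
    exists_between (by rwa [lt_div_iff₀ hI])
  rw [lt_div_iff₀ hI] at hc'
  have hc'0 : 0 < c' := hc.trans hcc'
  set η := 1 - c / c' with hη
  have hη0 : 0 < η := by rw [hη, sub_pos, div_lt_one hc'0]; exact hcc'
  obtain ⟨b, h, t, q, hb, hq, hev⟩ :=
    exists_exploration_parameters h0 h1 hc'0 hc' hℓ hΔ hlam hlog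
  obtain ⟨μ, hμ1, hμ2⟩ := exists_between h1
  have hμ0 : 0 < μ := h0.trans hμ1
  have hlogμ : Real.log μ < 0 := Real.log_neg hμ0 hμ2
  set r : ℕ → ℕ := fun n => ⌊η * Δ n⌋₊ with hr
  -- For a fixed `μ` in `(lam, 1)` this is at most about `ℓ * μ^(η * Δ)`, which vanishes because
  -- `log ℓ = o(Δ)`.
  have hdeg : Tendsto (fun n => (ℓ n : ℝ) * (ℓ n * odds (Δ n) (p n)) ^ r n) atTop (𝓝 0) := by
    have hexp : Tendsto (fun n => (Δ n : ℝ) * (Real.log (ℓ n) / Δ n + η * Real.log μ) +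
        -Real.log μ) atTop atBot := by
      refine tendsto_atBot_add_const_right _ _ ?_
      have := hlog.add_const (η * Real.log μ)
      rw [zero_add] at this
      exact hΔ.atTop_mul_neg (mul_neg_of_pos_of_neg hη0 hlogμ) this
    refine squeeze_zero' (Eventually.of_forall fun n => ?_) ?_ (Real.tendsto_exp_atBot.comp hexp)
    · have := odds_nonneg (Δ n) (p n)
      positivity
    · filter_upwards [hlam.eventually_lt_const hμ1, hev, hΔ.eventually_ge_atTop 1,
        hℓ.eventually_ge_atTop 1] with n hn1 hn2 hn3 hn4
      have hp : (0 : ℝ) < p n := by exact_mod_cast hn2.1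
      have hℓ0 : (0 : ℝ) < ℓ n := by linarith
      have hx : ℓ n * odds (Δ n) (p n) ≤ μ := by
        refine le_trans ?_ hn1.le
        rw [odds, ← mul_div_assoc]
        gcongr
        linarith
      have ho := odds_nonneg (Δ n) (p n)
      have hfl : η * Δ n - 1 ≤ r n := (Nat.sub_one_lt_floor _).le
      calc (ℓ n : ℝ) * (ℓ n * odds (Δ n) (p n)) ^ r n ≤ ℓ n * μ ^ r n := by gcongr
        _ = Real.exp (Real.log (ℓ n) + r n * Real.log μ) := by
            rw [Real.exp_add, Real.exp_log hℓ0, Real.exp_nat_mul, Real.exp_log hμ0]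
        _ ≤ _ := by
            simp only [Function.comp]
            rw [Real.exp_le_exp, mul_add, mul_div_cancel₀ _ (by linarith)]
            nlinarith
  have herr := hq.add hdeg
  rw [add_zero] at herr
  have hlim : Tendsto (fun n => ENNReal.ofReal (1 - ((1 - q n) ^ t n +
      (ℓ n : ℝ) * (ℓ n * odds (Δ n) (p n)) ^ r n))) atTop (𝓝 1) := by
    have := ENNReal.tendsto_ofReal (herr.const_sub 1)
    simpa using this
  refine tendsto_of_tendsto_of_tendsto_of_le_of_le' hlim tendsto_const_nhds ?_ ?_
  · filter_upwards [hev, hd, hs, hΔ.eventually_ge_atTop 1] with n hn hdn hsn hΔn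
    obtain ⟨hp, hh, hq1, hjn, a, P, ha, hP, hqn⟩ := hn
    obtain ⟨hdn, hAn, hpn⟩ := hdn
    have hgr := isGraphical_of_card hdn hpn
    rw [← hAn] at ha hqn
    have := le_uniformModel_largestComponentOrder (r := r n) hdn hgr hpn hp hb hh le_rfl ha hP
      hq1 hqn
    rw [hAn] at this
    refine this.trans (MeasureTheory.measure_mono fun G hG => ?_)
    rw [Set.mem_ofPred_eq] at hG ⊢
    have hG' : (((b * h n + 1) * (Δ n - r n) : ℕ) : ℝ) ≤ largestComponentOrder G := by
      exact_mod_cast hG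
    refine le_trans (hsn.trans ?_) hG'
    have hrn : (r n : ℝ) ≤ η * Δ n := Nat.floor_le (by positivity)
    have hrn' : r n ≤ Δ n := by
      have : (r n : ℝ) ≤ Δ n := by
        have : η ≤ 1 := by rw [hη]; linarith [div_nonneg hc.le hc'0.le]
        nlinarith
      exact_mod_cast this
    rw [Nat.cast_mul, Nat.cast_sub hrn']
    push_cast
    have h2 : c / c' * Δ n ≤ Δ n - r n := by
      have : c / c' = 1 - η := by rw [hη]; ring
      rw [this]
      linarith
    calc c * Δ n * Real.log (ℓ n) = (c' * Real.log (ℓ n)) * (c / c' * Δ n) := by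
          field_simp
      _ ≤ (b * h n + 1) * (Δ n - r n) := by
          gcongr
          linarith
  · filter_upwards [hd] with n hdn
    have hgr := isGraphical_of_card hdn.1 hdn.2.2
    have : MeasureTheory.IsProbabilityMeasure (DegreeSequence.uniformModel (d n)) :=
      ProbabilityTheory.isProbabilityMeasure_uniformOn (Set.toFinite _) hgr
    exact MeasureTheory.prob_le_one

end HubGraph

/-! ### The explicit degree sequence -/

namespace HubGraph

/-- The sequence with `N - ℓ` entries `1` followed by `ℓ` entries `Δ`. -/
def hubSequence (N ℓ Δ : ℕ) (i : Fin N) : ℕ := if i.val < N - ℓ then 1 else Δ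

/-- The positions of the last `ℓ` entries. -/
def hubs (N ℓ : ℕ) : Finset (Fin N) := (Finset.univ.filter fun i : Fin N => i.val < N - ℓ)ᶜ

lemma hubDegrees_hubSequence (N ℓ Δ : ℕ) : HubDegrees (hubSequence N ℓ Δ) (hubs N ℓ) Δ where
  hub v hv := by simp [hubs] at hv; simp [hubSequence, hv]
  leaf v hv := by simp [hubs] at hv; simp [hubSequence, hv]

lemma card_compl_hubs (N ℓ : ℕ) : (hubs N ℓ)ᶜ.card = N - ℓ := by
  rw [hubs, compl_compl, Fin.card_filter_val_lt]
  omega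

lemma card_hubs {N ℓ : ℕ} (h : ℓ ≤ N) : (hubs N ℓ).card = ℓ := by
  have h1 := card_compl_hubs N ℓ
  rw [Finset.card_compl, Fintype.card_fin] at h1
  have h2 : (hubs N ℓ).card ≤ N := by simpa using Finset.card_le_univ (hubs N ℓ)
  omega

lemma monotone_hubSequence (N ℓ : ℕ) {Δ : ℕ} (h : 1 ≤ Δ) : Monotone (hubSequence N ℓ Δ) := by
  intro i j hij
  have : i.val ≤ j.val := hij
  unfold hubSequence
  split_ifs <;> omega

lemma ncard_hubSequence_eq {N ℓ Δ : ℕ} (h : ℓ ≤ N) (hΔ : 2 ≤ Δ) :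
    {i | hubSequence N ℓ Δ i = Δ}.ncard = ℓ := by
  have : {i | hubSequence N ℓ Δ i = Δ} = (hubs N ℓ : Set (Fin N)) := by
    ext i
    by_cases hi : i ∈ hubs N ℓ
    · simp [hi, (hubDegrees_hubSequence N ℓ Δ).hub i hi]
    · simp [hi, (hubDegrees_hubSequence N ℓ Δ).leaf i hi]
      omega
  rw [this, Set.ncard_coe_finset, card_hubs h]

lemma maxDegree_hubSequence {N ℓ Δ : ℕ} (h : ℓ ≤ N) (h1 : 1 ≤ ℓ) (hΔ : 1 ≤ Δ) :
    DegreeSequence.maxDegree (hubSequence N ℓ Δ) = Δ := by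
  apply le_antisymm
  · refine Finset.sup_le fun i _ => ?_
    unfold hubSequence
    split_ifs <;> omega
  · have : (hubs N ℓ).Nonempty := by rw [← Finset.card_pos, card_hubs h]; omega
    obtain ⟨i, hi⟩ := this
    calc Δ = hubSequence N ℓ Δ i := ((hubDegrees_hubSequence N ℓ Δ).hub i hi).symm
      _ ≤ _ := Finset.le_sup (f := hubSequence N ℓ Δ) (Finset.mem_univ i)

end HubGraph

/-! ### Asymptotics of the parameters and the main theorem -/

open HubGraph in
theorem mainTheorem4 (Q : ℝ) (hQ_gt : -1 < Q) (hQ_neg : Q < 0) (Δ : ℕ → ℕ)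
    (hΔ_upper : (fun n => (Δ n : ℝ)) =o[atTop] fun n : ℕ => Real.sqrt (n : ℝ))
    (hΔ_lower : (fun n : ℕ => Real.log (n : ℝ)) =o[atTop] fun n => (Δ n : ℝ)) :
    ∃ (ℓ N : ℕ → ℕ) (d : ∀ n, Fin (N n) → ℕ),
      -- the shape of the sequence: `ℓ n` vertices of degree `Δ n`, all others of degree `1`,
      -- on `n` vertices, or `n + 1` if that is needed to make the degree sum even
      (∀ n, ℓ n = ⌊(1 + Q) * (n : ℝ) / (Δ n : ℝ) ^ 2⌋₊) ∧
      (∀ n, N n = if Even ((n - ℓ n) + ℓ n * Δ n) then n else n + 1) ∧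
      (∀ᶠ n in atTop,
        Monotone (d n) ∧
        {i | d n i = Δ n}.ncard = ℓ n ∧
        (∀ i, d n i ≠ Δ n → d n i = 1) ∧
        DegreeSequence.IsGraphical (d n) ∧
        DegreeSequence.maxDegree (d n) = Δ n) ∧
      (fun n => DegreeSequence.Q (d n)) ~[atTop] (fun _ => Q) ∧
      (fun n => DegreeSequence.R (d n)) ~[atTop] (fun n => (1 + Q) * (Δ n : ℝ)) ∧
      -- the lower bound on the largest component, with high probability
      ∃ δ : ℕ → ℝ, Tendsto δ atTop (𝓝 0) ∧
        Tendsto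
          (fun n => DegreeSequence.uniformModel (d n)
            {G | (1 + δ n) * (2 * DegreeSequence.R (d n) / Q ^ 2 *
                Real.log ((n : ℝ) / DegreeSequence.R (d n) ^ 2)) ≤
              (largestComponentOrder G : ℝ)})
          atTop (𝓝 1) := by
  set lam := 1 + Q with hlam_def
  have h0 : 0 < lam := by rw [hlam_def]; linarith
  have h1 : lam < 1 := by rw [hlam_def]; linarith
  set ℓ : ℕ → ℕ := fun n => ⌊lam * (n : ℝ) / (Δ n : ℝ) ^ 2⌋₊ with hℓ_def
  set N : ℕ → ℕ := fun n => if Even ((n - ℓ n) + ℓ n * Δ n) then n else n + 1 with hN_def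
  set p : ℕ → ℕ := fun n => (N n - ℓ n - ℓ n * Δ n) / 2 with hp_def
  -- limits of the parameters
  have hn : Tendsto (fun n : ℕ => (n : ℝ)) atTop atTop := tendsto_natCast_atTop_atTop
  have hlogn : Tendsto (fun n : ℕ => Real.log n / Δ n) atTop (𝓝 0) := hΔ_lower.tendsto_div_nhds_zero
  have hΔ0 : ∀ᶠ n in atTop, (0 : ℝ) < Δ n := by
    filter_upwards [hΔ_lower.bound (show (0 : ℝ) < 1 by norm_num),
      (Real.tendsto_log_atTop.comp hn).eventually_gt_atTop 0] with n h2 h3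
    simp only [Function.comp] at h3
    rw [one_mul, Real.norm_of_nonneg h3.le, Real.norm_of_nonneg (Nat.cast_nonneg _)] at h2
    linarith
  have hΔ : Tendsto (fun n => (Δ n : ℝ)) atTop atTop := by
    refine tendsto_atTop_mono' _ ?_ (Real.tendsto_log_atTop.comp hn)
    filter_upwards [hlogn.eventually_lt_const (show (0 : ℝ) < 1 by norm_num), hΔ0] with n h2 h3
    rw [div_lt_one h3] at h2
    exact h2.le
  have hX : Tendsto (fun n : ℕ => (n : ℝ) / (Δ n : ℝ) ^ 2) atTop atTop := by
    have h2 : Tendsto (fun n : ℕ => (Δ n : ℝ) ^ 2 / n) atTop (𝓝 0) := by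
      have h3 := hΔ_upper.tendsto_div_nhds_zero.pow 2
      rw [zero_pow two_ne_zero] at h3
      refine h3.congr fun n => ?_
      rw [div_pow, Real.sq_sqrt (Nat.cast_nonneg n)]
    have h3 : Tendsto (fun n : ℕ => (Δ n : ℝ) ^ 2 / n) atTop (𝓝[>] 0) := by
      refine tendsto_nhdsWithin_iff.2 ⟨h2, ?_⟩
      filter_upwards [hΔ0, eventually_gt_atTop 0] with n h3 h4
      have : (0 : ℝ) < n := by exact_mod_cast h4
      exact Set.mem_Ioi.2 (by positivity)
    refine h3.inv_tendsto_nhdsGT_zero.congr fun n => ?_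
    simp
  have hℓX : Tendsto (fun n => (ℓ n : ℝ) * (Δ n : ℝ) ^ 2 / n) atTop (𝓝 lam) := by
    refine ((tendsto_nat_floor_mul_div_atTop h0.le).comp hX).congr fun n => ?_
    simp only [Function.comp, hℓ_def]
    rw [← mul_div_assoc, div_div_eq_mul_div]
  have hℓ : Tendsto (fun n => (ℓ n : ℝ)) atTop atTop := by
    refine tendsto_natCast_atTop_atTop.comp (tendsto_nat_floor_atTop.comp ?_)
    refine (hX.const_mul_atTop h0).congr fun n => ?_
    rw [mul_div_assoc]
  have hℓΔ : Tendsto (fun n => (ℓ n : ℝ) * Δ n / n) atTop (𝓝 0) := by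
    refine (hℓX.div_atTop hΔ).congr' ?_
    filter_upwards [hΔ0] with n h2
    field_simp
  have hℓn : Tendsto (fun n => (ℓ n : ℝ) / n) atTop (𝓝 0) := by
    refine (hℓΔ.div_atTop hΔ).congr' ?_
    filter_upwards [hΔ0] with n h2
    field_simp
  have hN1 : ∀ n, n ≤ N n ∧ N n ≤ n + 1 := by
    intro n
    simp only [hN_def]
    split_ifs <;> omega
  have hN : Tendsto (fun n => (N n : ℝ) / n) atTop (𝓝 1) := by
    have h2 : Tendsto (fun n : ℕ => 1 + 1 / (n : ℝ)) atTop (𝓝 1) := by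
      simpa using (hn.const_div_atTop (1 : ℝ)).const_add 1
    refine tendsto_of_tendsto_of_tendsto_of_le_of_le' tendsto_const_nhds h2 ?_ ?_
    · filter_upwards [eventually_gt_atTop 0] with n h3
      rw [le_div_iff₀ (by exact_mod_cast h3), one_mul]
      exact_mod_cast (hN1 n).1
    · filter_upwards [eventually_gt_atTop 0] with n h3
      have h4 : (0 : ℝ) < n := by exact_mod_cast h3
      rw [div_le_iff₀ h4, add_mul, one_div_mul_cancel h4.ne', one_mul]
      exact_mod_cast (hN1 n).2
  have hfit : ∀ᶠ n in atTop, ℓ n ≤ n ∧ ℓ n * Δ n + ℓ n ≤ N n := by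
    filter_upwards [(hℓΔ.add hℓn).eventually_lt_const (show (0 : ℝ) + 0 < 1 by norm_num),
      eventually_gt_atTop 0] with n h2 h3
    have h4 : (0 : ℝ) < n := by exact_mod_cast h3
    rw [← add_div, div_lt_one h4] at h2
    have h5 : ℓ n * Δ n + ℓ n < n := by exact_mod_cast h2
    have := (hN1 n).1
    exact ⟨by omega, by omega⟩
  -- The halving in `p` is exact: an additional vertex has degree 1 and flips the parity of the
  -- degree sum, which is therefore even for `N n` vertices.
  have hpN : ∀ᶠ n in atTop, N n - ℓ n = 2 * p n + ℓ n * Δ n := by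
    filter_upwards [hfit] with n h2
    have h3 : Even (N n - ℓ n + ℓ n * Δ n) := by
      simp only [hN_def]
      split_ifs with h3
      · exact h3
      · rw [Nat.sub_add_comm h2.1, add_right_comm]
        exact Nat.even_add_one.2 h3
    obtain ⟨y, hy⟩ := h3
    simp only [hp_def]
    omega
  have hpn : Tendsto (fun n => (2 * p n : ℝ) / n) atTop (𝓝 1) := by
    have h2 := (hN.sub hℓn).sub hℓΔ
    rw [sub_zero, sub_zero] at h2
    refine h2.congr' ?_
    filter_upwards [hfit, hpN] with n h3 h4
    have h5 : N n = 2 * p n + ℓ n * Δ n + ℓ n := by omega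
    rw [h5]
    push_cast
    ring
  have hlam : Tendsto (fun n => (ℓ n : ℝ) * (Δ n : ℝ) ^ 2 / (2 * p n)) atTop (𝓝 lam) := by
    have h2 := hℓX.div hpn one_ne_zero
    rw [div_one] at h2
    refine h2.congr' ?_
    filter_upwards [eventually_gt_atTop 0] with n h3
    have h4 : (n : ℝ) ≠ 0 := by exact_mod_cast h3.ne'
    exact div_div_div_cancel_right₀ h4 _ _
  have hlog : Tendsto (fun n => Real.log (ℓ n) / Δ n) atTop (𝓝 0) := by
    refine squeeze_zero' (Eventually.of_forall fun n =>
      div_nonneg (Real.log_natCast_nonneg _) (Nat.cast_nonneg _)) ?_ hlogn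
    filter_upwards [hfit, hℓ.eventually_ge_atTop 1] with n h2 h3
    have h4 : (ℓ n : ℝ) ≤ n := by exact_mod_cast h2.1
    gcongr
  set d : ∀ n, Fin (N n) → ℕ := fun n => hubSequence (N n) (ℓ n) (Δ n) with hd_def
  have hd : ∀ n, HubDegrees (d n) (hubs (N n) (ℓ n)) (Δ n) := fun n =>
    hubDegrees_hubSequence _ _ _
  have hcard : ∀ᶠ n in atTop, (hubs (N n) (ℓ n)).card = ℓ n ∧
      (hubs (N n) (ℓ n))ᶜ.card = 2 * p n + (hubs (N n) (ℓ n)).card * Δ n := by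
    filter_upwards [hfit, hpN] with n h2 h3
    have h4 : (hubs (N n) (ℓ n)).card = ℓ n := card_hubs (by omega)
    rw [h4, card_compl_hubs]
    exact ⟨rfl, h3⟩
  -- the quantities `Q` and `R`
  have hm : Tendsto (fun n => ((ℓ n : ℝ) * Δ n + (2 * p n + ℓ n * Δ n)) / n) atTop (𝓝 1) := by
    have h2 := hℓΔ.add (hpn.add hℓΔ)
    simp only [add_zero, zero_add] at h2
    refine h2.congr fun n => ?_
    ring
  have hQ : Tendsto (fun n => DegreeSequence.Q (d n)) atTop (𝓝 Q) := by
    have h2 := ((hℓX.sub (hℓΔ.const_mul 2)).sub (hpn.add hℓΔ)).div hm one_ne_zero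
    have h3 : (lam - 2 * 0 - (1 + 0)) / 1 = Q := by rw [hlam_def]; ring
    rw [h3] at h2
    refine h2.congr' ?_
    filter_upwards [hcard, eventually_gt_atTop 0] with n h4 h5
    have h6 : (n : ℝ) ≠ 0 := by exact_mod_cast h5.ne'
    rw [Pi.div_apply, Q_of_hubDegrees (hd n), h4.2, h4.1]
    refine Eq.trans ?_ (div_div_div_cancel_right₀ h6 _ _)
    push_cast
    congr 1
    ring
  have hR : Tendsto (fun n => DegreeSequence.R (d n) / Δ n) atTop (𝓝 lam) := by
    have h2 := ((hℓX.mul (((hΔ.const_div_atTop (2 : ℝ)).const_sub 1).pow 2)).add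
      ((hpn.add hℓΔ).div_atTop hΔ)).div hm one_ne_zero
    have h3 : (lam * (1 - 0) ^ 2 + 0) / 1 = lam := by ring
    rw [h3] at h2
    refine h2.congr' ?_
    filter_upwards [hcard, eventually_gt_atTop 0, hΔ0] with n h4 h5 h7
    have h6 : (n : ℝ) ≠ 0 := by exact_mod_cast h5.ne'
    rw [Pi.div_apply, R_of_hubDegrees (hd n), h4.2, h4.1, div_right_comm]
    refine Eq.trans ?_ (div_div_div_cancel_right₀ h6 _ _)
    push_cast
    congr 1
    field_simp
  -- comparison of the bound with the component size
  have hR0 : ∀ᶠ n in atTop, 0 < DegreeSequence.R (d n) := by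
    filter_upwards [hR.eventually_const_lt h0, hΔ0] with n h2 h3
    exact (div_pos_iff_of_pos_right h3).1 h2
  -- `n / R²` and `ℓ` differ by an asymptotically constant factor, so their logarithms are
  -- equivalent.
  have hY : Tendsto (fun n : ℕ => (n : ℝ) / DegreeSequence.R (d n) ^ 2 / ℓ n) atTop
      (𝓝 (1 / (lam * lam ^ 2))) := by
    have h2 := (tendsto_const_nhds (x := (1 : ℝ))).div (hℓX.mul (hR.pow 2))
      (show lam * lam ^ 2 ≠ 0 by positivity)
    refine h2.congr' ?_
    filter_upwards [hΔ0, hR0, eventually_gt_atTop 0, hℓ.eventually_gt_atTop 0] with n h3 h4 h5 h6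
    have h5 : (0 : ℝ) < n := by exact_mod_cast h5
    rw [Pi.div_apply]
    field_simp
  have hLtop : Tendsto (fun n => Real.log (ℓ n)) atTop atTop := Real.tendsto_log_atTop.comp hℓ
  have hratio : Tendsto (fun n : ℕ => Real.log ((n : ℝ) / DegreeSequence.R (d n) ^ 2) /
      Real.log (ℓ n)) atTop (𝓝 1) := by
    have h2 := ((hY.log (by positivity)).div_atTop hLtop).const_add 1
    rw [add_zero] at h2
    refine h2.congr' ?_
    filter_upwards [hR0, eventually_gt_atTop 0, hℓ.eventually_gt_atTop 1] with n h4 h5 h6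
    have h5 : (0 : ℝ) < n := by exact_mod_cast h5
    have h7 : 0 < Real.log (ℓ n) := Real.log_pos h6
    have h8 : (0 : ℝ) < ℓ n := by linarith
    rw [Real.log_div (by positivity) (by positivity)]
    field_simp
    ring
  have hQ2 : (0 : ℝ) < Q ^ 2 := sq_pos_of_neg hQ_neg
  -- Here the constant of the proposition is compared with the true growth rate; the gap is strict
  -- because `0 < lam < 1`.
  obtain ⟨c, hc1, hc2⟩ : ∃ c, 2 * lam / Q ^ 2 < c ∧ c < 1 / (lam - 1 - Real.log lam) := by
    apply exists_between
    have h2 := sub_one_sub_log_lt h0 h1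
    have h3 : (0 : ℝ) < lam - 1 - Real.log lam := by
      have := Real.log_lt_sub_one_of_pos h0 h1.ne
      linarith
    have h4 : (1 - lam) ^ 2 = Q ^ 2 := by rw [hlam_def]; ring
    rw [h4, lt_div_iff₀ (by positivity)] at h2
    rw [div_lt_div_iff₀ hQ2 h3]
    linarith
  have hc0 : 0 < c := lt_trans (by positivity) hc1
  have hcI : c * (lam - 1 - Real.log lam) < 1 := by
    have h3 : (0 : ℝ) < lam - 1 - Real.log lam := by
      have := Real.log_lt_sub_one_of_pos h0 h1.ne
      linarith
    rwa [lt_div_iff₀ h3] at hc2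
  -- The gap between `2 * lam / Q ^ 2` and `c` absorbs all error terms, so `δ` can be taken to be
  -- zero.
  have hs : ∀ᶠ n : ℕ in atTop, (1 + (0 : ℝ)) * (2 * DegreeSequence.R (d n) / Q ^ 2 *
      Real.log ((n : ℝ) / DegreeSequence.R (d n) ^ 2)) ≤ c * Δ n * Real.log (ℓ n) := by
    have h2 := ((hR.const_mul 2).div_const (Q ^ 2)).mul hratio
    rw [mul_one] at h2
    filter_upwards [h2.eventually_lt_const hc1, hΔ0, hLtop.eventually_gt_atTop 0] with n h3 h4 h5
    have h6 := mul_le_mul_of_nonneg_right h3.le (mul_pos h4 h5).le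
    rw [← mul_assoc c] at h6
    refine le_trans (le_of_eq ?_) h6
    field_simp
    ring
  refine ⟨ℓ, N, d, fun n => rfl, fun n => rfl, ?_, ?_, ?_, fun _ => 0, tendsto_const_nhds, ?_⟩
  · filter_upwards [hfit, hcard, hΔ.eventually_ge_atTop 2, hℓ.eventually_ge_atTop 1]
      with n h2 h3 h4 h5
    have h4 : 2 ≤ Δ n := by exact_mod_cast h4
    have h5 : 1 ≤ ℓ n := by exact_mod_cast h5
    have h6 : ℓ n ≤ N n := by omega
    refine ⟨monotone_hubSequence _ _ (by omega), ncard_hubSequence_eq h6 h4, fun i hi => ?_,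
      isGraphical_of_card (hd n) h3.2, maxDegree_hubSequence h6 h5 (by omega)⟩
    by_contra h7
    by_cases h8 : i ∈ hubs (N n) (ℓ n)
    · exact hi ((hd n).hub i h8)
    · exact h7 ((hd n).leaf i h8)
  · exact (isEquivalent_const_iff_tendsto hQ_neg.ne).2 hQ
  · refine (isEquivalent_iff_tendsto_one ?_).2 ?_
    · filter_upwards [hΔ0] with n h2
      positivity
    · have h2 := hR.div_const lam
      rw [div_self h0.ne'] at h2
      refine h2.congr fun n => ?_
      simp only [Pi.div_apply]
      rw [div_div, mul_comm (Δ n : ℝ)]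
  · exact tendsto_uniformModel_largestComponentOrder h0 h1 hc0 hcI hℓ hΔ hlam hlog
      (hcard.mono fun n h => ⟨hd n, h⟩) hs
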